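/- Let $C(SU_{-1}(2))$ be the universal unital $C^*$-algebra with generators $\alpha,\gamma$ and relations $$\alpha^*\alpha+\gamma^*\gamma=1,\quad \alpha\alpha^*+\gamma\gamma^*=1,\quad \alpha\gamma=-\gamma\alpha,\quad \alpha\gamma^*=-\gamma^*\alpha,\quad \gamma\gamma^*=\gamma^*\gamma .$$ Identify $SU(2)$ with $\{(a,c)\in\mathbb C^2 : |a|^2+|c|^2=1\}$. For $(a,c)\in SU(2)$ let $\pi_{(a,c)}$ be the following irreducible representation of $C(SU_{-1}(2))$: if $ac=0$, it is the one-dimensional representation on $\mathbb C$ with $\alpha\mapsto a$, $\gamma\mapsto c$; if $ac\neq 0$, it is the representation on $\mathbb C^2$ with $$\alpha\mapsto\begin{pmatrix}a&0\\0&-a\end{pmatrix},\qquad \gamma\mapsto\begin{pmatrix}0&c\\c&0\end{pmatrix}.$$ Let $G=\mathbb Z/2\oplus\mathbb Z/2$ act on $SU(2)$ by letting its two generators act as $(a,c)\mapsto(-a,c)$ and $(a,c)\mapsto(a,-c)$. Let $X=SU(2)/\sim$, with the quotient topology, where a point $(a,c)$ with $ac\neq0$ is equivalent exactly to the points of its $G$-orbit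 $\{(\pm a,\pm c)\}$, and a point with $ac=0$ is equivalent only to itself. **Theorem 2.1.** The map $$\Pi\colon X\to C(SU_{-1}(2))^{\wedge},\qquad [(a,c)]\mapsto[\pi_{(a,c)}],$$ is a well-defined bijection and a homeomorphism onto the spectrum of $C(SU_{-1}(2))$, that is, the set of unitary equivalence classes of irreducible representations, with the topology pulled back along $[\pi]\mapsto\ker\pi$ from the Jacobson (hull-kernel) topology on the primitive ideal space. -/

import Mathlib

set_option linter.unusedSectionVars false

noncomputable section

/-! ### Universal unital C*-algebras -/

/-- A C*-seminorm on a complex unital `*`-algebra. -/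
structure CStarSeminorm (P : Type*) [Ring P] [StarRing P] [Algebra ℂ P] extends Seminorm ℂ P where
  mul_le' : ∀ x y : P, toFun (x * y) ≤ toFun x * toFun y
  cstar' : ∀ x : P, toFun (star x * x) = toFun x * toFun x

namespace CStarSeminorm

variable {P : Type*} [Ring P] [StarRing P] [Algebra ℂ P] [StarModule ℂ P]

theorem star_eq (p : CStarSeminorm P) (x : P) : p.toSeminorm (star x) = p.toSeminorm x := by
  have key : ∀ y : P, p.toSeminorm y ≤ p.toSeminorm (star y) := by
    intro y
    have h0 : 0 ≤ p.toSeminorm y := apply_nonneg _ _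
    have h1 : p.toSeminorm y * p.toSeminorm y ≤ p.toSeminorm (star y) * p.toSeminorm y := by
      rw [← show _ = p.toSeminorm y * p.toSeminorm y from p.cstar' y]
      exact p.mul_le' _ _
    rcases h0.eq_or_lt with h | h
    · rw [← h]; exact apply_nonneg _ _
    · exact le_of_mul_le_mul_right h1 h
  exact le_antisymm (by simpa using key (star x)) (key x)

/-- The `*`-algebra `P`, regarded as a seminormed space through `p`. -/
@[nolint unusedArguments]
def Pre (_p : CStarSeminorm P) : Type _ := P

variable (p : CStarSeminorm P)

instance : Ring p.Pre := inferInstanceAs (Ring P)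
instance : StarRing p.Pre := inferInstanceAs (StarRing P)
instance : Algebra ℂ p.Pre := inferInstanceAs (Algebra ℂ P)
instance : StarModule ℂ p.Pre := inferInstanceAs (StarModule ℂ P)

instance : SeminormedRing p.Pre where
  toRing := inferInstance
  toPseudoMetricSpace := p.toSeminorm.toSeminormedAddCommGroup.toPseudoMetricSpace
  norm := p.toSeminorm
  dist_eq x y := p.toSeminorm.toSeminormedAddCommGroup.dist_eq x y
  norm_mul_le := p.mul_le'

theorem norm_def (x : p.Pre) : ‖x‖ = p.toSeminorm (show P from x) := rfl

instance : NormedAlgebra ℂ p.Pre where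
  norm_smul_le c x := (map_smul_eq_mul p.toSeminorm c (show P from x)).le

instance : NormedStarGroup p.Pre where
  norm_star_le x := (p.star_eq x).le

/-- The C*-completion of `P` with respect to `p`: divide by the null space and complete. -/
def Compl : Type _ := UniformSpace.Completion p.Pre

namespace Compl
open UniformSpace

instance : NormedRing p.Compl := inferInstanceAs (NormedRing (Completion p.Pre))
instance : Algebra ℂ p.Compl := inferInstanceAs (Algebra ℂ (Completion p.Pre))
instance : CompleteSpace p.Compl := inferInstanceAs (CompleteSpace (Completion p.Pre))

/-- The canonical map from `P` to its completion. -/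
def of : P →ₐ[ℂ] p.Compl where
  toRingHom := (Completion.coeRingHom : p.Pre →+* Completion p.Pre)
  commutes' _ := rfl

theorem norm_of (x : P) : ‖of p x‖ = p.toSeminorm x := Completion.norm_coe (E := p.Pre) x

theorem denseRange_of : DenseRange (of p) := Completion.denseRange_coe (α := p.Pre)

@[elab_as_elim]
theorem induction {motive : p.Compl → Prop} (x : p.Compl) (hc : IsClosed {x | motive x})
    (h : ∀ y : P, motive (of p y)) : motive x :=
  (denseRange_of p).induction_on x hc h

instance : NormedAlgebra ℂ p.Compl where
  norm_smul_le c x := norm_smul_le (β := Completion p.Pre) c x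

instance : Star p.Compl := ⟨Completion.map (star : p.Pre → p.Pre)⟩

theorem continuous_star' : Continuous (star : p.Compl → p.Compl) :=
  Completion.continuous_map

theorem star_of (x : P) : star (of p x) = of p (star x) :=
  Completion.map_coe (f := (star : p.Pre → p.Pre)) star_isometry.uniformContinuous x

instance : ContinuousStar p.Compl := ⟨continuous_star' p⟩

instance : StarRing p.Compl where
  star_involutive x := by
    refine induction p x ?_ ?_
    · exact isClosed_eq (by fun_prop) (by fun_prop)
    · intro y; rw [star_of, star_of, star_star]
  star_mul x y := by
    refine induction p x ?_ fun a => induction p y ?_ fun b => ?_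
    · exact isClosed_eq (by fun_prop) (by fun_prop)
    · exact isClosed_eq (by fun_prop) (by fun_prop)
    · rw [star_of, star_of, ← map_mul, star_of, star_mul, map_mul]
  star_add x y := by
    refine induction p x ?_ fun a => induction p y ?_ fun b => ?_
    · exact isClosed_eq (by fun_prop) (by fun_prop)
    · exact isClosed_eq (by fun_prop) (by fun_prop)
    · rw [star_of, star_of, ← map_add, star_of, star_add, map_add]

instance : CStarRing p.Compl where
  norm_mul_self_le x := by
    refine induction p x ?_ fun a => ?_
    · exact isClosed_le (by fun_prop) (by fun_prop)
    · rw [star_of, ← map_mul, norm_of, norm_of]; exact (p.cstar' a).ge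

instance : StarModule ℂ p.Compl where
  star_smul c x := by
    refine induction p x ?_ fun a => ?_
    · exact isClosed_eq (continuous_star.comp (continuous_const_smul c))
        ((continuous_const_smul (star c)).comp continuous_star)
    · rw [star_of, ← map_smul, star_of, star_smul, map_smul]

instance : CStarAlgebra p.Compl where

/-- The canonical map as a `*`-homomorphism. -/
def ofStar : P →⋆ₐ[ℂ] p.Compl := { of p with map_star' := fun x => (star_of p x).symm }

@[simp] theorem ofStar_apply (x : P) : ofStar p x = of p x := rfl

variable {p} {B : Type*} [CStarAlgebra B]

theorem uniformContinuous_of_le (f : P →⋆ₐ[ℂ] B) (hf : ∀ x, ‖f x‖ ≤ p.toSeminorm x) :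
    UniformContinuous (fun x : p.Pre => f (show P from x)) :=
  (AddMonoidHomClass.lipschitz_of_bound (show p.Pre →+ B from (f : P →+ B)) 1
    (fun x => by exact (hf x).trans (one_mul _).ge)).uniformContinuous

/-- A `*`-homomorphism dominated by `p` extends to the completion. -/
def lift (f : P →⋆ₐ[ℂ] B) (hf : ∀ x, ‖f x‖ ≤ p.toSeminorm x) : p.Compl →⋆ₐ[ℂ] B :=
  let F : p.Compl → B := Completion.extension (fun x : p.Pre => f (show P from x))
  have hF : Continuous F := Completion.continuous_extension
  have hof : ∀ x : P, F (of p x) = f x := fun x =>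
    Completion.extension_coe (uniformContinuous_of_le f hf) x
  { toFun := F
    map_one' := by rw [← map_one (of p), hof, map_one]
    map_zero' := by rw [← map_zero (of p), hof, map_zero]
    map_mul' := fun x y => by
      refine induction p x ?_ fun a => induction p y ?_ fun b => ?_
      · exact isClosed_eq (by fun_prop) (by fun_prop)
      · exact isClosed_eq (by fun_prop) (by fun_prop)
      · rw [← map_mul, hof, hof, hof, map_mul]
    map_add' := fun x y => by
      refine induction p x ?_ fun a => induction p y ?_ fun b => ?_
      · exact isClosed_eq (by fun_prop) (by fun_prop)
      · exact isClosed_eq (by fun_prop) (by fun_prop)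
      · rw [← map_add, hof, hof, hof, map_add]
    commutes' := fun c => by
      rw [← AlgHom.commutes (of p), hof, AlgHomClass.commutes]
    map_star' := fun x => by
      refine induction p x ?_ fun a => ?_
      · exact isClosed_eq (by fun_prop) (by fun_prop)
      · rw [star_of, hof, hof, map_star] }

@[simp] theorem lift_of (f : P →⋆ₐ[ℂ] B) (hf : ∀ x, ‖f x‖ ≤ p.toSeminorm x) (x : P) :
    lift f hf (of p x) = f x :=
  Completion.extension_coe (uniformContinuous_of_le f hf) x

end Compl

/-- The C*-seminorm `x ↦ ‖f x‖` of a `*`-homomorphism into a C*-algebra. -/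
def ofHom {B : Type*} [CStarAlgebra B] (f : P →⋆ₐ[ℂ] B) : CStarSeminorm P where
  toSeminorm := (normSeminorm ℂ B).comp (f : P →ₗ[ℂ] B)
  mul_le' x y := by
    change ‖f (x * y)‖ ≤ ‖f x‖ * ‖f y‖
    rw [map_mul]; exact norm_mul_le _ _
  cstar' x := by
    change ‖f (star x * x)‖ = ‖f x‖ * ‖f x‖
    rw [map_mul, map_star]; exact CStarRing.norm_star_mul_self

/-- The supremum of a non-empty, pointwise bounded family of C*-seminorms. -/
def sup (S : Set (CStarSeminorm P)) (hne : S.Nonempty)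
    (hb : ∀ x : P, ∃ M : ℝ, ∀ p ∈ S, p.toSeminorm x ≤ M) : CStarSeminorm P :=
  have : Nonempty S := hne.to_subtype
  have hbdd : ∀ x : P, BddAbove (Set.range fun p : S => p.1.toSeminorm x) := fun x => by
    obtain ⟨M, hM⟩ := hb x
    exact ⟨M, by rintro _ ⟨p, rfl⟩; exact hM p.1 p.2⟩
  have hle : ∀ (x : P) (p : S), p.1.toSeminorm x ≤ ⨆ p : S, p.1.toSeminorm x :=
    fun x p => le_ciSup (hbdd x) p
  have h0 : ∀ x : P, 0 ≤ ⨆ p : S, p.1.toSeminorm x := fun x =>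
    Real.iSup_nonneg fun p => apply_nonneg _ _
  { toFun := fun x => ⨆ p : S, p.1.toSeminorm x
    map_zero' := by simp
    add_le' := fun x y => ciSup_le fun p =>
      (map_add_le_add p.1.toSeminorm x y).trans (add_le_add (hle x p) (hle y p))
    neg' := fun x => by simp
    smul' := fun c x => by
      simp only [map_smul_eq_mul]
      exact (Real.mul_iSup_of_nonneg (norm_nonneg c) _).symm
    mul_le' := fun x y => ciSup_le fun p =>
      (p.1.mul_le' x y).trans (mul_le_mul (hle x p) (hle y p) (apply_nonneg p.1.toSeminorm _) (h0 x))
    cstar' := fun x => by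
      have hc : ∀ p : S, p.1.toSeminorm (star x * x) = p.1.toSeminorm x * p.1.toSeminorm x :=
        fun p => p.1.cstar' x
      apply le_antisymm
      · refine ciSup_le fun p => ?_
        rw [hc]
        exact mul_le_mul (hle x p) (hle x p) (apply_nonneg _ _) (h0 x)
      · have hs : (⨆ p : S, p.1.toSeminorm x) ≤ √(⨆ p : S, p.1.toSeminorm (star x * x)) :=
          ciSup_le fun p => Real.le_sqrt_of_sq_le (by rw [sq, ← hc]; exact hle _ p)
        exact (mul_self_le_mul_self (h0 x) hs).trans_eq (Real.mul_self_sqrt (h0 _)) }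

theorem le_sup {S : Set (CStarSeminorm P)} (hne : S.Nonempty)
    (hb : ∀ x : P, ∃ M : ℝ, ∀ p ∈ S, p.toSeminorm x ≤ M) {p : CStarSeminorm P} (hp : p ∈ S)
    (x : P) : p.toSeminorm x ≤ (sup S hne hb).toSeminorm x := by
  obtain ⟨M, hM⟩ := hb x
  exact le_ciSup (f := fun p : S => p.1.toSeminorm x)
    ⟨M, by rintro _ ⟨p, rfl⟩; exact hM p.1 p.2⟩ ⟨p, hp⟩

theorem sup_le {S : Set (CStarSeminorm P)} (hne : S.Nonempty)
    (hb : ∀ x : P, ∃ M : ℝ, ∀ p ∈ S, p.toSeminorm x ≤ M) {x : P} {c : ℝ}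
    (h : ∀ p ∈ S, p.toSeminorm x ≤ c) : (sup S hne hb).toSeminorm x ≤ c :=
  have : Nonempty S := hne.to_subtype
  ciSup_le fun p => h p.1 p.2

instance : Zero (CStarSeminorm P) :=
  ⟨{ toSeminorm := 0, mul_le' := fun _ _ => (zero_mul _).ge, cstar' := fun _ => (zero_mul _).symm }⟩

theorem zero_apply (x : P) : (0 : CStarSeminorm P).toSeminorm x = 0 := rfl

end CStarSeminorm

/-! ### Free `*`-algebras -/

/-- Words in the letters `g` (coded `(g, false)`) and `g*` (coded `(g, true)`), `g ∈ X`. -/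
abbrev StarWord (X : Type*) : Type _ := FreeMonoid (X × Bool)

/-- The free complex unital `*`-algebra on the set `X`: linear combinations of words in the
letters `g`, `g*`. -/
def FreeStarAlgebra (X : Type*) : Type _ := MonoidAlgebra ℂ (StarWord X)

namespace FreeStarAlgebra

variable {X : Type*}

instance : Ring (FreeStarAlgebra X) := inferInstanceAs (Ring (MonoidAlgebra ℂ (StarWord X)))
instance : Algebra ℂ (FreeStarAlgebra X) :=
  inferInstanceAs (Algebra ℂ (MonoidAlgebra ℂ (StarWord X)))

/-- The monomial given by a word. -/
def word : StarWord X →* FreeStarAlgebra X := MonoidAlgebra.of ℂ (StarWord X)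

/-- The generator belonging to `g`. -/
def gen (g : X) : FreeStarAlgebra X := word (FreeMonoid.of (g, false))

theorem induction {motive : FreeStarAlgebra X → Prop} (x : FreeStarAlgebra X)
    (hw : ∀ w, motive (word w)) (ha : ∀ x y, motive x → motive y → motive (x + y))
    (hs : ∀ (c : ℂ) x, motive x → motive (c • x)) : motive x :=
  MonoidAlgebra.induction_on (motive := motive) x hw ha hs

/-- The adjoint of a word: reverse it and exchange `g` with `g*`. -/
def starWord : StarWord X →* (FreeStarAlgebra X)ᵐᵒᵖ :=
  FreeMonoid.lift fun l => MulOpposite.op (word (FreeMonoid.of (l.1, !l.2)))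

/-- The conjugate-linear anti-multiplicative extension of the adjoint of words. -/
def starHom : FreeStarAlgebra X →+* (FreeStarAlgebra X)ᵐᵒᵖ :=
  MonoidAlgebra.liftNCRingHom
    ((algebraMap ℂ (FreeStarAlgebra X)ᵐᵒᵖ).comp (starRingEnd ℂ)) starWord
    fun c _ => Algebra.commutes (starRingEnd ℂ c) _

theorem starHom_word (w : StarWord X) : starHom (word w) = starWord w := by
  have := MonoidAlgebra.liftNCRingHom_single
    ((algebraMap ℂ (FreeStarAlgebra X)ᵐᵒᵖ).comp (starRingEnd ℂ)) (starWord (X := X))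
    (fun c _ => Algebra.commutes (starRingEnd ℂ c) _) w 1
  rw [map_one, one_mul] at this
  exact this

theorem starHom_algebraMap (c : ℂ) : starHom (algebraMap ℂ (FreeStarAlgebra X) c) =
    algebraMap ℂ (FreeStarAlgebra X)ᵐᵒᵖ (star c) := by
  have := MonoidAlgebra.liftNCRingHom_single
    ((algebraMap ℂ (FreeStarAlgebra X)ᵐᵒᵖ).comp (starRingEnd ℂ)) (starWord (X := X))
    (fun c _ => Algebra.commutes (starRingEnd ℂ c) _) 1 c
  rw [map_one, mul_one] at this
  exact this

theorem starHom_smul (c : ℂ) (x : FreeStarAlgebra X) : starHom (c • x) = star c • starHom x := by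
  rw [Algebra.smul_def, map_mul, starHom_algebraMap, ← Algebra.smul_def]

theorem starHom_starWord (w : StarWord X) : starHom (starWord w).unop = MulOpposite.op (word w) := by
  induction w using FreeMonoid.inductionOn' with
  | one => simp
  | of_mul l w ih =>
    rw [map_mul, MulOpposite.unop_mul, map_mul, ih, map_mul word, MulOpposite.op_mul]
    congr 1
    simp [starWord, starHom_word]

instance : StarRing (FreeStarAlgebra X) where
  star x := (starHom x).unop
  star_involutive x := by
    change (starHom (starHom x).unop).unop = x
    induction x using induction with
    | hw w => rw [starHom_word, starHom_starWord]; rfl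
    | ha x y hx hy => rw [map_add, MulOpposite.unop_add, map_add, MulOpposite.unop_add, hx, hy]
    | hs c x hx =>
      rw [starHom_smul, MulOpposite.unop_smul, starHom_smul, MulOpposite.unop_smul, hx, star_star]
  star_mul x y := by rw [map_mul, MulOpposite.unop_mul]
  star_add x y := by rw [map_add, MulOpposite.unop_add]

theorem star_def (x : FreeStarAlgebra X) : star x = (starHom x).unop := rfl

instance : StarModule ℂ (FreeStarAlgebra X) where
  star_smul c x := by rw [star_def, starHom_smul, MulOpposite.unop_smul, star_def]

variable {B : Type*} [Ring B] [StarRing B] [Algebra ℂ B] [StarModule ℂ B]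

/-- The value of a letter under an assignment of the generators. -/
def letterVal (f : X → B) (l : X × Bool) : B := if l.2 then star (f l.1) else f l.1

theorem star_gen (g : X) : star (gen g) = word (FreeMonoid.of (g, true)) := by
  simp [star_def, gen, starHom_word, starWord]

/-- The algebra homomorphism determined by an assignment of the generators. -/
def liftAlg (f : X → B) : FreeStarAlgebra X →ₐ[ℂ] B :=
  MonoidAlgebra.lift ℂ B (StarWord X) (FreeMonoid.lift (letterVal f))

theorem liftAlg_word (f : X → B) (w : StarWord X) :
    liftAlg f (word w) = FreeMonoid.lift (letterVal f) w :=
  MonoidAlgebra.lift_of (R := ℂ) (FreeMonoid.lift (letterVal f)) w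

theorem liftAlg_star (f : X → B) (x : FreeStarAlgebra X) : liftAlg f (star x) = star (liftAlg f x) := by
  induction x using induction with
  | hw w =>
    rw [star_def, starHom_word]
    induction w using FreeMonoid.inductionOn' with
    | one => simp
    | of_mul l w ih =>
      rw [map_mul, MulOpposite.unop_mul, map_mul, ih, map_mul word, map_mul, star_mul]
      congr 1
      rcases l with ⟨g, b⟩
      cases b <;> simp [starWord, liftAlg_word, letterVal]
  | ha x y hx hy => simp [hx, hy]
  | hs c x hx => simp [hx, star_smul]

/-- The universal property of the free `*`-algebra. -/
def lift (f : X → B) : FreeStarAlgebra X →⋆ₐ[ℂ] B :=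
  { liftAlg f with map_star' := liftAlg_star f }

@[simp] theorem lift_gen (f : X → B) (g : X) : lift f (gen g) = f g := by
  change liftAlg f (gen g) = f g
  simp [gen, liftAlg_word, letterVal]

theorem hom_ext {f f' : FreeStarAlgebra X →⋆ₐ[ℂ] B} (h : ∀ g, f (gen g) = f' (gen g)) : f = f' := by
  ext x
  induction x using induction with
  | hw w =>
    induction w using FreeMonoid.inductionOn' with
    | one => simp
    | of_mul l w ih =>
      rw [map_mul, map_mul, map_mul, ih]
      congr 1
      rcases l with ⟨g, b⟩
      cases b
      · exact h g
      · rw [← star_gen, map_star, map_star, h g]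
  | ha x y hx hy => simp [hx, hy]
  | hs c x hx => simp [hx]

end FreeStarAlgebra

/-! ### The C*-algebra of continuous functions on quantum SU(2) -/

/-- The defining relations of `C(SU_q(2))` for a pair `(a, c)` of elements of a `*`-algebra. -/
structure SUqRel (q : ℝ) {B : Type*} [Ring B] [StarRing B] [Algebra ℂ B] (a c : B) : Prop where
  rel_one : star a * a + star c * c = 1
  rel_two : a * star a + ((q : ℂ) ^ 2) • (c * star c) = 1
  rel_three : a * c = (q : ℂ) • (c * a)
  rel_four : a * star c = (q : ℂ) • (star c * a)
  rel_five : c * star c = star c * c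

theorem SUqRel.map {q : ℝ} {B C : Type*} [Ring B] [StarRing B] [Algebra ℂ B]
    [Ring C] [StarRing C] [Algebra ℂ C] (f : B →⋆ₐ[ℂ] C) {a c : B} (h : SUqRel q a c) :
    SUqRel q (f a) (f c) where
  rel_one := by simp only [← map_star, ← map_mul, ← map_add, h.rel_one, map_one]
  rel_two := by simp only [← map_star, ← map_mul, ← map_smul, ← map_add, h.rel_two, map_one]
  rel_three := by simp only [← map_mul, ← map_smul, h.rel_three]
  rel_four := by simp only [← map_star, ← map_mul, ← map_smul, h.rel_four]
  rel_five := by simp only [← map_star, ← map_mul, h.rel_five]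

theorem norm_le_one_of_star_mul_self_add {B : Type*} [CStarAlgebra B] {a c : B}
    (h : star a * a + star c * c = 1) : ‖a‖ ≤ 1 := by
  let _ := CStarAlgebra.spectralOrder B
  have := CStarAlgebra.spectralOrderedRing B
  have h1 : star a * a ≤ 1 := by
    rw [← h]; exact le_add_of_nonneg_right (star_mul_self_nonneg c)
  have h2 := (CStarAlgebra.norm_le_one_iff_of_nonneg _ (star_mul_self_nonneg a)).2 h1
  rw [CStarRing.norm_star_mul_self] at h2
  nlinarith [norm_nonneg a]

/-- The two generators `α`, `γ`. -/
inductive SUqGen where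
  | alpha
  | gamma

namespace SUq

open CStarSeminorm FreeStarAlgebra

/-- The C*-seminorms on the free `*`-algebra on `α`, `γ` in whose completion `α` and `γ` satisfy the
defining relations. -/
def admissible (q : ℝ) : Set (CStarSeminorm (FreeStarAlgebra SUqGen)) :=
  {p | SUqRel q (Compl.ofStar p (gen SUqGen.alpha)) (Compl.ofStar p (gen SUqGen.gamma))}

theorem admissible_nonempty (q : ℝ) : (admissible q).Nonempty := by
  have h : ∀ x y : CStarSeminorm.Compl (0 : CStarSeminorm (FreeStarAlgebra SUqGen)), x = y := by
    have h0 : ∀ x : CStarSeminorm.Compl (0 : CStarSeminorm (FreeStarAlgebra SUqGen)), x = 0 := by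
      intro x
      refine Compl.induction _ x (isClosed_eq continuous_id continuous_const) fun y => ?_
      rw [← norm_eq_zero, Compl.norm_of, CStarSeminorm.zero_apply]
    intro x y; rw [h0 x, h0 y]
  exact ⟨0, ⟨h _ _, h _ _, h _ _, h _ _, h _ _⟩⟩

theorem admissible_gen_le {q : ℝ} {p : CStarSeminorm (FreeStarAlgebra SUqGen)}
    (hp : p ∈ admissible q) (g : SUqGen) : p.toSeminorm (gen g) ≤ 1 := by
  rw [← Compl.norm_of]
  cases g
  · exact norm_le_one_of_star_mul_self_add hp.rel_one
  · exact norm_le_one_of_star_mul_self_add ((add_comm _ _).trans hp.rel_one)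

theorem admissible_bdd (q : ℝ) (x : FreeStarAlgebra SUqGen) :
    ∃ M : ℝ, ∀ p ∈ admissible q, p.toSeminorm x ≤ M := by
  induction x using FreeStarAlgebra.induction with
  | hw w =>
    refine ⟨1, fun p hp => ?_⟩
    induction w using FreeMonoid.inductionOn' with
    | one =>
      rw [map_one]
      have h1 : p.toSeminorm 1 = p.toSeminorm 1 * p.toSeminorm 1 := by
        have := p.cstar' 1
        rwa [star_one, one_mul] at this
      nlinarith [sq_nonneg (p.toSeminorm 1 - 1)]
    | of_mul l w ih =>
      rw [map_mul]
      have hl : p.toSeminorm (word (FreeMonoid.of l)) ≤ 1 := by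
        rcases l with ⟨g, b⟩
        cases b
        · exact admissible_gen_le hp g
        · rw [← star_gen, p.star_eq]; exact admissible_gen_le hp g
      exact (p.mul_le' _ _).trans (mul_le_one₀ hl (apply_nonneg p.toSeminorm _) ih)
  | ha x y hx hy =>
    obtain ⟨M, hM⟩ := hx
    obtain ⟨N, hN⟩ := hy
    exact ⟨M + N, fun p hp =>
      (map_add_le_add p.toSeminorm x y).trans (add_le_add (hM p hp) (hN p hp))⟩
  | hs c x hx =>
    obtain ⟨M, hM⟩ := hx
    refine ⟨‖c‖ * M, fun p hp => ?_⟩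
    rw [map_smul_eq_mul]
    exact mul_le_mul_of_nonneg_left (hM p hp) (norm_nonneg c)

/-- The largest C*-seminorm compatible with the relations. -/
def univSeminorm (q : ℝ) : CStarSeminorm (FreeStarAlgebra SUqGen) :=
  CStarSeminorm.sup (admissible q) (admissible_nonempty q) (admissible_bdd q)

end SUq

/-- `C(SU_q(2))`: the universal unital C*-algebra generated by `α`, `γ` subject to the relations
`SUqRel q α γ`, i.e. the completion of the free `*`-algebra on `α`, `γ` with respect to the largest
C*-seminorm compatible with the relations. -/
abbrev SUq (q : ℝ) : Type := (SUq.univSeminorm q).Compl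

namespace SUq

open CStarSeminorm FreeStarAlgebra

/-- The generator `α` of `C(SU_q(2))`. -/
def alpha (q : ℝ) : SUq q := Compl.ofStar _ (gen SUqGen.alpha)

/-- The generator `γ` of `C(SU_q(2))`. -/
def gamma (q : ℝ) : SUq q := Compl.ofStar _ (gen SUqGen.gamma)

theorem of_eq_of {q : ℝ} {x y : FreeStarAlgebra SUqGen}
    (h : ∀ p ∈ admissible q, Compl.ofStar p x = Compl.ofStar p y) :
    Compl.ofStar (univSeminorm q) x = Compl.ofStar (univSeminorm q) y := by
  rw [← sub_eq_zero, ← map_sub, ← norm_eq_zero, Compl.ofStar_apply, Compl.norm_of]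
  refine le_antisymm (sup_le _ _ fun p hp => ?_) (apply_nonneg _ _)
  rw [← Compl.norm_of, ← Compl.ofStar_apply, map_sub, h p hp, sub_self, norm_zero]

/-- The generators of `C(SU_q(2))` satisfy the relations. -/
theorem rel (q : ℝ) : SUqRel q (alpha q) (gamma q) where
  rel_one := by
    have := of_eq_of (q := q) (x := star (gen .alpha) * gen .alpha + star (gen .gamma) * gen .gamma)
      (y := 1) fun p hp => by simpa only [map_add, map_mul, map_star, map_one] using hp.rel_one
    simpa only [alpha, gamma, map_add, map_mul, map_star, map_one] using this
  rel_two := by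
    have := of_eq_of (q := q)
      (x := gen .alpha * star (gen .alpha) + ((q : ℂ) ^ 2) • (gen .gamma * star (gen .gamma)))
      (y := 1) fun p hp => by
        simpa only [map_add, map_mul, map_star, map_one, map_smul] using hp.rel_two
    simpa only [alpha, gamma, map_add, map_mul, map_star, map_one, map_smul] using this
  rel_three := by
    have := of_eq_of (q := q) (x := gen .alpha * gen .gamma)
      (y := (q : ℂ) • (gen .gamma * gen .alpha)) fun p hp => by
        simpa only [map_mul, map_smul] using hp.rel_three
    simpa only [alpha, gamma, map_mul, map_smul] using this
  rel_four := by
    have := of_eq_of (q := q) (x := gen .alpha * star (gen .gamma))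
      (y := (q : ℂ) • (star (gen .gamma) * gen .alpha)) fun p hp => by
        simpa only [map_mul, map_star, map_smul] using hp.rel_four
    simpa only [alpha, gamma, map_mul, map_star, map_smul] using this
  rel_five := by
    have := of_eq_of (q := q) (x := gen .gamma * star (gen .gamma))
      (y := star (gen .gamma) * gen .gamma) fun p hp => by
        simpa only [map_mul, map_star] using hp.rel_five
    simpa only [alpha, gamma, map_mul, map_star] using this

section lift

variable {q : ℝ} {B : Type*} [CStarAlgebra B]

/-- The assignment `α ↦ a`, `γ ↦ c`. -/
def assign (a c : B) : SUqGen → B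
  | .alpha => a
  | .gamma => c

theorem assign_le {a c : B} (h : SUqRel q a c) (x : FreeStarAlgebra SUqGen) :
    ‖FreeStarAlgebra.lift (assign a c) x‖ ≤ (univSeminorm q).toSeminorm x := by
  set f := FreeStarAlgebra.lift (assign a c) with hf
  refine le_sup (p := CStarSeminorm.ofHom f) _ _ ?_ x
  have hfa : f (gen .alpha) = a := lift_gen _ _
  have hfc : f (gen .gamma) = c := lift_gen _ _
  have key : ∀ x y : FreeStarAlgebra SUqGen, f x = f y →
      Compl.ofStar (CStarSeminorm.ofHom f) x = Compl.ofStar (CStarSeminorm.ofHom f) y := by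
    intro x y hxy
    rw [← sub_eq_zero, ← map_sub, ← norm_eq_zero, Compl.ofStar_apply, Compl.norm_of]
    change ‖f (x - y)‖ = 0
    rw [map_sub, hxy, sub_self, norm_zero]
  exact
    { rel_one := by
        have := key (star (gen .alpha) * gen .alpha + star (gen .gamma) * gen .gamma) 1
          (by simpa only [map_add, map_mul, map_star, map_one, hfa, hfc] using h.rel_one)
        simpa only [map_add, map_mul, map_star, map_one] using this
      rel_two := by
        have := key
          (gen .alpha * star (gen .alpha) + ((q : ℂ) ^ 2) • (gen .gamma * star (gen .gamma))) 1
          (by simpa only [map_add, map_mul, map_star, map_one, map_smul, hfa, hfc] using h.rel_two)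
        simpa only [map_add, map_mul, map_star, map_one, map_smul] using this
      rel_three := by
        have := key (gen .alpha * gen .gamma) ((q : ℂ) • (gen .gamma * gen .alpha))
          (by simpa only [map_mul, map_smul, hfa, hfc] using h.rel_three)
        simpa only [map_mul, map_smul] using this
      rel_four := by
        have := key (gen .alpha * star (gen .gamma)) ((q : ℂ) • (star (gen .gamma) * gen .alpha))
          (by simpa only [map_mul, map_star, map_smul, hfa, hfc] using h.rel_four)
        simpa only [map_mul, map_star, map_smul] using this
      rel_five := by
        have := key (gen .gamma * star (gen .gamma)) (star (gen .gamma) * gen .gamma)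
          (by simpa only [map_mul, map_star, hfa, hfc] using h.rel_five)
        simpa only [map_mul, map_star] using this }

/-- The universal property of `C(SU_q(2))`, existence: for elements `a`, `c` of a unital C*-algebra
satisfying the relations there is a `*`-homomorphism with `α ↦ a` and `γ ↦ c`. -/
def lift (a c : B) (h : SUqRel q a c) : SUq q →⋆ₐ[ℂ] B :=
  Compl.lift (FreeStarAlgebra.lift (assign a c)) (assign_le h)

@[simp] theorem lift_alpha (a c : B) (h : SUqRel q a c) : lift a c h (alpha q) = a :=
  (Compl.lift_of _ _ _).trans (lift_gen _ _)

@[simp] theorem lift_gamma (a c : B) (h : SUqRel q a c) : lift a c h (gamma q) = c :=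
  (Compl.lift_of _ _ _).trans (lift_gen _ _)

/-- The universal property of `C(SU_q(2))`, uniqueness. -/
theorem hom_ext {f f' : SUq q →⋆ₐ[ℂ] B} (ha : f (alpha q) = f' (alpha q))
    (hc : f (gamma q) = f' (gamma q)) : f = f' := by
  have h : f.comp (Compl.ofStar _) = f'.comp (Compl.ofStar _) :=
    FreeStarAlgebra.hom_ext fun g => by cases g <;> assumption
  have hf : Continuous f :=
    AddMonoidHomClass.continuous_of_bound f 1 fun x => by
      rw [one_mul]; exact NonUnitalStarAlgHom.norm_apply_le f x
  have hf' : Continuous f' :=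
    AddMonoidHomClass.continuous_of_bound f' 1 fun x => by
      rw [one_mul]; exact NonUnitalStarAlgHom.norm_apply_le f' x
  ext x
  refine Compl.induction _ x (isClosed_eq hf hf') fun y => ?_
  exact DFunLike.congr_fun h y

end lift

end SUq

/-! ### Spectrum and primitive ideal space of a unital C*-algebra -/

universe u

/-- A unital `*`-representation of `A` on a Hilbert space. The space is taken in the universe of `A`,
which loses no irreducible representation up to equivalence, as these are cyclic. -/
structure HilbertRep (A : Type u) [CStarAlgebra A] where
  /-- The Hilbert space. -/
  H : Type u
  [normed : NormedAddCommGroup H]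
  [inner : InnerProductSpace ℂ H]
  [complete : CompleteSpace H]
  /-- The representation. -/
  hom : A →⋆ₐ[ℂ] (H →L[ℂ] H)

namespace HilbertRep

attribute [instance] HilbertRep.normed HilbertRep.inner HilbertRep.complete

variable {A : Type u} [CStarAlgebra A]

/-- Irreducibility: the space is non-zero, and there is no proper non-zero closed invariant
subspace. -/
def IsIrreducible (π : HilbertRep A) : Prop :=
  Nontrivial π.H ∧ ∀ K : Submodule ℂ π.H, IsClosed (K : Set π.H) →
    (∀ x : A, ∀ v ∈ K, π.hom x v ∈ K) → K = ⊥ ∨ K = ⊤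

/-- Unitary equivalence. -/
def Equivalent (π ρ : HilbertRep A) : Prop :=
  ∃ U : π.H ≃ₗᵢ[ℂ] ρ.H, ∀ (x : A) (v : π.H), U (π.hom x v) = ρ.hom x (U v)

/-- The kernel, a two-sided ideal. -/
def kernel (π : HilbertRep A) : TwoSidedIdeal A := TwoSidedIdeal.ker π.hom

theorem mem_kernel {π : HilbertRep A} {x : A} : x ∈ π.kernel ↔ π.hom x = 0 :=
  TwoSidedIdeal.mem_ker _

theorem Equivalent.kernel_eq {π ρ : HilbertRep A} (h : π.Equivalent ρ) : π.kernel = ρ.kernel := by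
  obtain ⟨U, hU⟩ := h
  ext x
  rw [mem_kernel, mem_kernel]
  constructor
  · intro hx
    ext v
    obtain ⟨w, rfl⟩ := U.surjective v
    rw [← hU, hx]; simp
  · intro hx
    ext v
    apply U.injective
    rw [hU, hx]; simp

end HilbertRep

/-- Irreducible representations. -/
abbrev IrrRep (A : Type u) [CStarAlgebra A] : Type _ := {π : HilbertRep A // π.IsIrreducible}

/-- Unitary equivalence is an equivalence relation. -/
def IrrRep.setoid (A : Type u) [CStarAlgebra A] : Setoid (IrrRep A) where
  r π ρ := π.1.Equivalent ρ.1
  iseqv :=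
    { refl := fun π => ⟨LinearIsometryEquiv.refl ℂ π.1.H, fun _ _ => rfl⟩
      symm := fun {π ρ} ⟨U, hU⟩ => ⟨U.symm, fun x v => by
        apply U.injective
        rw [hU]; simp⟩
      trans := fun {π ρ σ} ⟨U, hU⟩ ⟨V, hV⟩ => ⟨U.trans V, fun x v => by
        simp [hU, hV]⟩ }

/-- The primitive ideals of `A`: the kernels of irreducible representations. -/
abbrev PrimitiveIdeal (A : Type u) [CStarAlgebra A] : Type u :=
  {J : TwoSidedIdeal A // ∃ π : IrrRep A, π.1.kernel = J}

/-- The hull of a subset of `A`: the primitive ideals containing it. -/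
def PrimitiveIdeal.hull {A : Type u} [CStarAlgebra A] (S : Set A) : Set (PrimitiveIdeal A) :=
  {J | ∀ x ∈ S, x ∈ J.1}

/-- Primitive ideals are prime. -/
theorem PrimitiveIdeal.mem_or_mem {A : Type u} [CStarAlgebra A] (J : PrimitiveIdeal A) {s t : A}
    (h : ∀ x : A, s * x * t ∈ J.1) : s ∈ J.1 ∨ t ∈ J.1 := by
  obtain ⟨J, π, rfl⟩ := J
  simp only [HilbertRep.mem_kernel] at h ⊢
  by_contra! hst
  obtain ⟨v, hv⟩ : ∃ v, π.1.hom t v ≠ 0 := by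
    by_contra! hv
    exact hst.2 (ContinuousLinearMap.ext hv)
  let K : Submodule ℂ π.1.H := ⨅ x : A, LinearMap.ker (π.1.hom (s * x) : π.1.H →ₗ[ℂ] π.1.H)
  have hK : ∀ w, w ∈ K ↔ ∀ x : A, π.1.hom (s * x) w = 0 := fun w => by simp [K]
  have hKc : IsClosed (K : Set π.1.H) := by
    have : (K : Set π.1.H) = ⋂ x : A, {w | π.1.hom (s * x) w = 0} := by
      ext w; simp [hK]
    rw [this]
    exact isClosed_iInter fun x => isClosed_eq (π.1.hom (s * x)).continuous continuous_const
  rcases π.2.2 K hKc (fun y w hw => (hK _).2 fun x => by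
      have := (hK w).1 hw (x * y)
      rwa [← mul_assoc, map_mul] at this) with h0 | h0
  · have : π.1.hom t v ∈ K := (hK _).2 fun x => by
      have := DFunLike.congr_fun (h x) v
      rwa [map_mul] at this
    rw [h0] at this
    exact hv this
  · apply hst.1
    ext w
    have := (hK w).1 (by rw [h0]; trivial) 1
    rwa [mul_one] at this

/-- The Jacobson (hull-kernel) topology on the primitive ideal space: the closed sets are the
hulls. -/
instance PrimitiveIdeal.topology (A : Type u) [CStarAlgebra A] :
    TopologicalSpace (PrimitiveIdeal A) :=
  TopologicalSpace.ofClosed {Z | ∃ S : Set A, Z = PrimitiveIdeal.hull S}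
    ⟨Set.univ, by
      ext J
      simp only [Set.mem_empty_iff_false, false_iff]
      intro hJ
      obtain ⟨J, π, rfl⟩ := J
      have := π.2.1
      have h1 := HilbertRep.mem_kernel.1 (hJ 1 trivial)
      rw [map_one] at h1
      exact one_ne_zero h1⟩
    (fun 𝒵 h𝒵 => by
      refine ⟨{x | ∃ S : Set A, PrimitiveIdeal.hull S ∈ 𝒵 ∧ x ∈ S}, ?_⟩
      ext J
      simp only [Set.mem_sInter]
      constructor
      · rintro h x ⟨S, hS, hx⟩
        exact h _ hS x hx
      · intro h Z hZ
        obtain ⟨S, rfl⟩ := h𝒵 hZ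
        exact fun x hx => h x ⟨S, hZ, hx⟩)
    (fun Z₁ h₁ Z₂ h₂ => by
      obtain ⟨S, rfl⟩ := h₁
      obtain ⟨T, rfl⟩ := h₂
      refine ⟨{y | ∃ s ∈ S, ∃ x : A, ∃ t ∈ T, y = s * x * t}, ?_⟩
      ext J
      constructor
      · rintro (h | h) _ ⟨s, hs, x, t, ht, rfl⟩
        · exact J.1.mul_mem_right _ _ (J.1.mul_mem_right _ _ (h s hs))
        · exact J.1.mul_mem_left _ _ (h t ht)
      · intro h
        by_contra hn
        rw [Set.mem_union, not_or] at hn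
        simp only [PrimitiveIdeal.hull, Set.mem_ofPred_eq, not_forall] at hn
        obtain ⟨⟨s, hs, hsJ⟩, t, ht, htJ⟩ := hn
        rcases J.mem_or_mem fun x => h _ ⟨s, hs, x, t, ht, rfl⟩ with h' | h'
        · exact hsJ h'
        · exact htJ h')

/-- The spectrum of `A`: unitary equivalence classes of irreducible representations. -/
def CStarSpectrum (A : Type u) [CStarAlgebra A] : Type _ := Quotient (IrrRep.setoid A)

namespace CStarSpectrum

variable {A : Type u} [CStarAlgebra A]

/-- The class of an irreducible representation. -/
def mk (π : IrrRep A) : CStarSpectrum A := Quotient.mk _ π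

/-- The canonical surjection from the spectrum onto the primitive ideal space. -/
def toPrim : CStarSpectrum A → PrimitiveIdeal A :=
  Quotient.lift (fun π => ⟨π.1.kernel, π, rfl⟩) fun _ _ h => Subtype.ext h.kernel_eq

/-- The Jacobson topology on the spectrum, pulled back from the primitive ideal space. -/
instance : TopologicalSpace (CStarSpectrum A) := TopologicalSpace.induced toPrim inferInstance

end CStarSpectrum

/-! ### The space `X`, the representations `π_{(a,c)}`, and the map `Π` -/

/-- `SU(2)`, identified with the unit sphere `{(a, c) : |a|² + |c|² = 1}` of `ℂ²` (the pair `(a, c)`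
stands for the matrix with first column `(a, c)` and second column `(-c̄, ā)`). -/
abbrev SU2 : Type := {x : ℂ × ℂ // ‖x.1‖ ^ 2 + ‖x.2‖ ^ 2 = 1}

namespace SU2

/-- The first coordinate `a`. -/
def a (x : SU2) : ℂ := x.1.1

/-- The second coordinate `c`. -/
def c (x : SU2) : ℂ := x.1.2

/-- The symmetry `(a, c) ↦ (-a, c)`. -/
def r (x : SU2) : SU2 := ⟨(-x.a, x.c), by simpa [a, c] using x.2⟩

/-- The symmetry `(a, c) ↦ (a, -c)`. -/
def s (x : SU2) : SU2 := ⟨(x.a, -x.c), by simpa [a, c] using x.2⟩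

/-- The orbit of a point under the group `G = ℤ/2 ⊕ ℤ/2` generated by `r` and `s`. -/
def orbit (x : SU2) : Set SU2 := {x, x.r, x.s, x.r.s}

/-- The relation: points with `ac ≠ 0` are identified with the points of their orbit, every other
point is only identified with itself. -/
def Rel (x y : SU2) : Prop := x = y ∨ (x.a * x.c ≠ 0 ∧ y ∈ x.orbit)

theorem r_r (x : SU2) : x.r.r = x := by ext <;> simp [r, a, c]
theorem s_s (x : SU2) : x.s.s = x := by ext <;> simp [s, a, c]
theorem s_r (x : SU2) : x.s.r = x.r.s := by ext <;> simp [r, s, a, c]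

theorem ac_r (x : SU2) : x.r.a * x.r.c = -(x.a * x.c) := by simp [r, a, c]
theorem ac_s (x : SU2) : x.s.a * x.s.c = -(x.a * x.c) := by simp [s, a, c]

theorem mem_orbit {x y : SU2} : y ∈ x.orbit ↔ y = x ∨ y = x.r ∨ y = x.s ∨ y = x.r.s := Iff.rfl

/-- `SU2.Rel` is an equivalence relation. -/
def setoid : Setoid SU2 where
  r := Rel
  iseqv :=
    { refl := fun x => Or.inl rfl
      symm := by
        rintro x y (rfl | ⟨h, hy⟩)
        · exact Or.inl rfl
        · refine Or.inr ?_
          rcases mem_orbit.1 hy with rfl | rfl | rfl | rfl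
          · exact ⟨h, hy⟩
          · exact ⟨by rw [ac_r]; exact neg_ne_zero.2 h, by simp [mem_orbit, r_r]⟩
          · exact ⟨by rw [ac_s]; exact neg_ne_zero.2 h, by simp [mem_orbit, s_s]⟩
          · exact ⟨by rw [ac_s, ac_r, neg_neg]; exact h, by simp [mem_orbit, s_r, s_s, r_r]⟩
      trans := by
        rintro x y z (rfl | ⟨h, hy⟩) (rfl | ⟨h', hz⟩)
        · exact Or.inl rfl
        · exact Or.inr ⟨h', hz⟩
        · exact Or.inr ⟨h, hy⟩
        · refine Or.inr ⟨h, ?_⟩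
          rcases mem_orbit.1 hy with rfl | rfl | rfl | rfl <;>
            rcases mem_orbit.1 hz with rfl | rfl | rfl | rfl <;>
            simp [mem_orbit, s_r, s_s, r_r] }

theorem normSq (x : SU2) : star x.a * x.a + star x.c * x.c = 1 := by
  have h : ‖x.a‖ ^ 2 + ‖x.c‖ ^ 2 = 1 := x.2
  change (starRingEnd ℂ) x.a * x.a + (starRingEnd ℂ) x.c * x.c = 1
  rw [Complex.conj_mul', Complex.conj_mul']
  exact_mod_cast h

end SU2

/-- The quotient space `X = SU(2) / ∼`, with the quotient topology. -/
abbrev XSpace : Type := Quotient SU2.setoid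

namespace SU2

/-- The Hilbert space `ℂ²`. -/
abbrev C2 : Type := EuclideanSpace ℂ (Fin 2)

/-- The operator on `ℂ²` given by a matrix. -/
abbrev op (M : Matrix (Fin 2) (Fin 2) ℂ) : C2 →L[ℂ] C2 := Matrix.toEuclideanCLM (𝕜 := ℂ) M

theorem rel_one_dim (x : SU2) (h : x.a * x.c = 0) :
    SUqRel (-1) (x.a • (1 : ℂ →L[ℂ] ℂ)) (x.c • (1 : ℂ →L[ℂ] ℂ)) := by
  have hr : SUqRel (-1) x.a x.c := by
    refine ⟨x.normSq, ?_, ?_, ?_, mul_comm _ _⟩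
    · have := x.normSq
      simp only [smul_eq_mul]; push_cast; linear_combination this
    · rw [mul_comm x.c, h, smul_zero]
    · have : x.a * star x.c = 0 := by
        rcases mul_eq_zero.1 h with h | h <;> simp [h]
      rw [mul_comm (star x.c), this, smul_zero]
  have := hr.map (StarAlgHom.ofId ℂ (ℂ →L[ℂ] ℂ))
  simpa [StarAlgHom.ofId_apply, Algebra.algebraMap_eq_smul_one] using this

theorem rel_two_dim (x : SU2) :
    SUqRel (-1) (op !![x.a, 0; 0, -x.a]) (op !![0, x.c; x.c, 0]) := by
  have h := x.normSq
  have hA : star !![x.a, 0; 0, -x.a] = !![star x.a, 0; 0, -star x.a] := by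
    ext i j; fin_cases i <;> fin_cases j <;> simp [Matrix.star_apply]
  have hC : star !![0, x.c; x.c, 0] = !![0, star x.c; star x.c, 0] := by
    ext i j; fin_cases i <;> fin_cases j <;> simp [Matrix.star_apply]
  have hr : SUqRel (-1) (!![x.a, 0; 0, -x.a]) (!![0, x.c; x.c, 0]) := by
    constructor <;> rw [← sub_eq_zero] <;> (try rw [hA]) <;> (try rw [hC]) <;>
      ext i j <;> fin_cases i <;> fin_cases j <;>
      simp only [Matrix.mul_fin_two, Matrix.sub_apply, Matrix.add_apply, Matrix.smul_apply,
        Matrix.one_apply, Matrix.of_apply, Matrix.cons_val', Matrix.cons_val_zero,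
        Matrix.cons_val_one, Matrix.cons_val_fin_one, Fin.zero_eta, Fin.mk_one, Fin.isValue,
        smul_eq_mul, Matrix.zero_apply, if_true, zero_ne_one, one_ne_zero, if_false] <;>
      push_cast <;>
      first
        | ring1
        | linear_combination h
  exact hr.map (Matrix.toEuclideanCLM (𝕜 := ℂ) (n := Fin 2)).toStarAlgHom

/-- The representation `π_{(a,c)}` of `C(SU_{-1}(2))`. If `ac = 0` it is the character `α ↦ a`,
`γ ↦ c` on the one-dimensional Hilbert space `ℂ`; otherwise it is the two-dimensional representation
`α ↦ diag(a, -a)`, `γ ↦ antidiag(c, c)`. -/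
def rep (x : SU2) : HilbertRep (SUq (-1)) :=
  open Classical in
  if h : x.a * x.c = 0 then
    { H := ℂ, hom := SUq.lift _ _ (rel_one_dim x h) }
  else
    { H := C2, hom := SUq.lift _ _ (rel_two_dim x) }

theorem rep_irreducible (x : SU2) : x.rep.IsIrreducible := by
  unfold rep
  split_ifs with h
  · refine ⟨inferInstanceAs (Nontrivial ℂ), fun K _ _ => ?_⟩
    exact eq_bot_or_eq_top (α := Submodule ℂ ℂ) K
  · obtain ⟨ha, hc⟩ := mul_ne_zero_iff.1 h
    refine ⟨inferInstanceAs (Nontrivial C2), fun (K : Submodule ℂ C2) _ hinv => ?_⟩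
    rw [or_iff_not_imp_left]
    intro hK
    have hα : ∀ v ∈ K, op !![x.a, 0; 0, -x.a] v ∈ K := fun v hv => by
      have := hinv (SUq.alpha (-1)) v hv
      simpa only [SUq.lift_alpha] using this
    have hγ : ∀ v ∈ K, op !![0, x.c; x.c, 0] v ∈ K := fun v hv => by
      have := hinv (SUq.gamma (-1)) v hv
      simpa only [SUq.lift_gamma] using this
    obtain ⟨v, hv, hv0⟩ := (Submodule.ne_bot_iff K).1 hK
    have hα' : ∀ v : C2, v ∈ K → !₂[v 0, -v 1] ∈ K := fun v hv => by
      have := K.smul_mem x.a⁻¹ (hα v hv)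
      convert this using 1
      ext i; fin_cases i <;> simp [op, Matrix.vecHead, Matrix.vecTail, ha]
    have hγ' : ∀ v : C2, v ∈ K → !₂[v 1, v 0] ∈ K := fun v hv => by
      have := K.smul_mem x.c⁻¹ (hγ v hv)
      convert this using 1
      ext i; fin_cases i <;> simp [op, Matrix.vecHead, Matrix.vecTail, hc]
    have h0 : ∀ v : C2, v ∈ K → !₂[v 0, 0] ∈ K := fun v hv => by
      have := K.smul_mem (2⁻¹ : ℂ) (K.add_mem hv (hα' v hv))
      convert this using 1
      ext i; fin_cases i
      · simp; ring
      · simp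
    obtain ⟨w, hw, hw0⟩ : ∃ w ∈ K, w 0 ≠ 0 := by
      by_cases h' : v 0 = 0
      · refine ⟨_, hγ' v hv, fun h1 => hv0 ?_⟩
        ext i; fin_cases i
        · exact h'
        · exact h1
      · exact ⟨v, hv, h'⟩
    have he0 : !₂[(1 : ℂ), 0] ∈ K := by
      have := K.smul_mem (w 0)⁻¹ (h0 w hw)
      convert this using 1
      ext i; fin_cases i <;> simp [hw0]
    have he1 : !₂[(0 : ℂ), 1] ∈ K := hγ' _ he0
    rw [eq_top_iff]
    intro u _
    have := K.add_mem (K.smul_mem (u 0) he0) (K.smul_mem (u 1) he1)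
    convert this using 1
    ext i; fin_cases i <;> simp

/-- Equality of `U ∘ π = ρ ∘ U` may be checked on the generators. -/
theorem equivalent_of_gen {q : ℝ} {H K : Type} [NormedAddCommGroup H] [InnerProductSpace ℂ H]
    [CompleteSpace H] [NormedAddCommGroup K] [InnerProductSpace ℂ K] [CompleteSpace K]
    (f : SUq q →⋆ₐ[ℂ] (H →L[ℂ] H)) (g : SUq q →⋆ₐ[ℂ] (K →L[ℂ] K)) (U : H ≃ₗᵢ[ℂ] K)
    (ha : ∀ v, U (f (SUq.alpha q) v) = g (SUq.alpha q) (U v))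
    (hc : ∀ v, U (f (SUq.gamma q) v) = g (SUq.gamma q) (U v)) :
    HilbertRep.Equivalent ⟨H, f⟩ ⟨K, g⟩ := by
  have h : (U.conjStarAlgEquiv.toStarAlgHom).comp f = g := by
    apply SUq.hom_ext
    · ext v
      change U (f _ (U.symm v)) = _
      rw [ha]; simp
    · ext v
      change U (f _ (U.symm v)) = _
      rw [hc]; simp
  refine ⟨U, fun x v => ?_⟩
  change U (f x v) = g x (U v)
  rw [← h]
  change _ = U (f _ (U.symm (U v)))
  simp

theorem rep_of_ne (x : SU2) (h : x.a * x.c ≠ 0) :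
    x.rep = { H := C2, hom := SUq.lift _ _ (rel_two_dim x) } := dif_neg h

theorem op_comm {M A B : Matrix (Fin 2) (Fin 2) ℂ} (h : M * A = B * M) (v : C2) :
    op M (op A v) = op B (op M v) := by
  have h1 : op (M * A) = op M * op A := map_mul _ _ _
  have h2 : op (B * M) = op B * op M := map_mul _ _ _
  have h3 : op M * op A = op B * op M := by rw [← h1, ← h2, h]
  exact DFunLike.congr_fun h3 v

/-- A unitary matrix intertwining the generators intertwines the representations. -/
theorem rep_equivalent_of_matrix {x y : SU2} (hx : x.a * x.c ≠ 0) (hy : y.a * y.c ≠ 0)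
    (M : Matrix (Fin 2) (Fin 2) ℂ) (hM : M ∈ unitary (Matrix (Fin 2) (Fin 2) ℂ))
    (ha : M * !![x.a, 0; 0, -x.a] = !![y.a, 0; 0, -y.a] * M)
    (hc : M * !![0, x.c; x.c, 0] = !![0, y.c; y.c, 0] * M) :
    x.rep.Equivalent y.rep := by
  have hU : op M ∈ unitary (C2 →L[ℂ] C2) :=
    Unitary.map_mem (Matrix.toEuclideanCLM (𝕜 := ℂ) (n := Fin 2)) hM
  obtain ⟨U, hUv⟩ : ∃ U : C2 ≃ₗᵢ[ℂ] C2, ∀ v, U v = op M v :=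
    ⟨Unitary.linearIsometryEquiv ⟨op M, hU⟩, fun _ => rfl⟩
  rw [rep_of_ne x hx, rep_of_ne y hy]
  refine equivalent_of_gen _ _ U (fun v => ?_) fun v => ?_
  · rw [SUq.lift_alpha, SUq.lift_alpha, hUv, hUv, op_comm ha]
  · rw [SUq.lift_gamma, SUq.lift_gamma, hUv, hUv, op_comm hc]

theorem rep_equivalent_r (x : SU2) (h : x.a * x.c ≠ 0) : x.rep.Equivalent x.r.rep := by
  refine rep_equivalent_of_matrix h (by rw [ac_r]; exact neg_ne_zero.2 h) !![0, 1; 1, 0] ?_ ?_ ?_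
  · rw [Unitary.mem_iff]
    constructor <;> ext i j <;> fin_cases i <;> fin_cases j <;>
      simp [Matrix.mul_apply, Matrix.star_apply]
  · simp [r, a]
  · simp [r, c]

theorem rep_equivalent_s (x : SU2) (h : x.a * x.c ≠ 0) : x.rep.Equivalent x.s.rep := by
  refine rep_equivalent_of_matrix h (by rw [ac_s]; exact neg_ne_zero.2 h) !![1, 0; 0, -1] ?_ ?_ ?_
  · rw [Unitary.mem_iff]
    constructor <;> ext i j <;> fin_cases i <;> fin_cases j <;>
      simp [Matrix.mul_apply, Matrix.star_apply]
  · simp [s, a]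
  · simp [s, c]

/-- The class of `π_{(a,c)}` in the spectrum. -/
def repClass (x : SU2) : CStarSpectrum (SUq (-1)) := CStarSpectrum.mk ⟨x.rep, x.rep_irreducible⟩

theorem repClass_eq {x y : SU2} (h : x.rep.Equivalent y.rep) : x.repClass = y.repClass :=
  Quotient.sound h

theorem repClass_eq_of_rel {x y : SU2} (h : Rel x y) : x.repClass = y.repClass := by
  rcases h with rfl | ⟨h, hy⟩
  · rfl
  · rcases mem_orbit.1 hy with rfl | rfl | rfl | rfl
    · rfl
    · exact repClass_eq (rep_equivalent_r x h)
    · exact repClass_eq (rep_equivalent_s x h)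
    · exact (repClass_eq (rep_equivalent_r x h)).trans
        (repClass_eq (rep_equivalent_s x.r (by rw [ac_r]; exact neg_ne_zero.2 h)))

end SU2

/-- The map `Π : [(a, c)] ↦ [π_{(a,c)}]` from `X` to the spectrum of `C(SU_{-1}(2))`. -/
def PiMap : XSpace → CStarSpectrum (SUq (-1)) :=
  Quotient.lift SU2.repClass fun _ _ h => SU2.repClass_eq_of_rel h

theorem PiMap_mk (x : SU2) :
    PiMap (Quotient.mk SU2.setoid x) = CStarSpectrum.mk ⟨x.rep, x.rep_irreducible⟩ := rfl

end

/-! Surjectivity. In an irreducible representation put `A = π(α)` and `C = π(γ)`. Both are normal,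
and `A` anticommutes with `C` and `C*`, so `A²`, `C²` and `A*A` commute with everything and are
scalars by Schur's lemma. If one of `A`, `C` vanishes, the other is itself a scalar and `π` is one
of the characters. Otherwise write `A² = a²`, `C² = c²`. A unit vector `v` in the range of `A + a`
satisfies `Av = av`, and with `w = c⁻¹Cv` the orthonormal pair `v, w` spans an invariant plane on
which `A` and `C` are the matrices of `π_{(a,c)}` (`exists_plane`). By irreducibility this plane is
the whole space.

Continuity. Closed sets of the spectrum are hulls, so the sets `{x | π_x(s) = 0}` must be closed.
The two-dimensional formula makes sense at every point of `SU(2)` and depends continuously on it.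
Where `ac = 0`, the character `π_x` is a subrepresentation spanned by an eigenvector that is
constant on `c = 0` and constant on `a = 0`. The set in question is therefore a union of three
closed sets.

Injectivity and closedness. Both follow from `exists_separating`: a closed saturated set `F` and a
point `y` outside it are separated by an element killed by `π_x` for `x ∈ F` but not by `π_y`. Since
`α²` and `γ²` act as the scalars `a²` and `c²` in every `π_x`, functional calculus produces bump
functions around the orbit of `y`. These suffice when the orbit is a single class. If `ac = 0` at
`y`, the orbit is `{y, -y}`, and a second factor, the positive part of the real inner product with
`y`, removes `-y`. -/

/-! ### Reduction to the generators -/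

open CStarSeminorm FreeStarAlgebra in
/-- To prove a closed property of all elements of `C(SU_q(2))`, it suffices to build them up from
`1` by left multiplication with the generators and their adjoints, sums and scalar multiples. -/
@[elab_as_elim]
theorem SUq.induction_on {q : ℝ} {motive : SUq q → Prop} (x : SUq q)
    (closed : IsClosed {x | motive x}) (one : motive 1)
    (alpha_mul : ∀ x, motive x → motive (SUq.alpha q * x))
    (star_alpha_mul : ∀ x, motive x → motive (star (SUq.alpha q) * x))
    (gamma_mul : ∀ x, motive x → motive (SUq.gamma q * x))
    (star_gamma_mul : ∀ x, motive x → motive (star (SUq.gamma q) * x))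
    (add : ∀ x y, motive x → motive y → motive (x + y))
    (smul : ∀ (c : ℂ) x, motive x → motive (c • x)) : motive x := by
  refine Compl.induction _ x closed fun y => ?_
  induction y using FreeStarAlgebra.induction with
  | hw w =>
    induction w using FreeMonoid.inductionOn' with
    | one => rw [map_one, map_one]; exact one
    | of_mul l w ih =>
      rw [map_mul, map_mul]
      rcases l with ⟨_ | _, _ | _⟩
      · exact alpha_mul _ ih
      · rw [← star_gen, ← Compl.star_of]; exact star_alpha_mul _ ih
      · exact gamma_mul _ ih
      · rw [← star_gen, ← Compl.star_of]; exact star_gamma_mul _ ih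
  | ha x y hx hy => rw [map_add]; exact add _ _ hx hy
  | hs c x hx => rw [map_smul]; exact smul _ _ hx

theorem StarAlgHom.continuous_of_cstarAlgebra {A B : Type*} [CStarAlgebra A] [CStarAlgebra B]
    (f : A →⋆ₐ[ℂ] B) : Continuous f :=
  AddMonoidHomClass.continuous_of_bound f 1 fun x => by
    rw [one_mul]; exact NonUnitalStarAlgHom.norm_apply_le f x

namespace SUq

section intertwine

variable {q : ℝ} {H K : Type*} [NormedAddCommGroup H] [InnerProductSpace ℂ H] [CompleteSpace H]
  [NormedAddCommGroup K] [InnerProductSpace ℂ K] [CompleteSpace K]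

/-- Whether a bounded operator intertwines two representations of `C(SU_q(2))` may be checked on
the generators and their adjoints. -/
theorem intertwines (f : SUq q →⋆ₐ[ℂ] (H →L[ℂ] H)) (g : SUq q →⋆ₐ[ℂ] (K →L[ℂ] K)) (T : H →L[ℂ] K)
    (ha : ∀ v, T (f (alpha q) v) = g (alpha q) (T v))
    (ha' : ∀ v, T (star (f (alpha q)) v) = star (g (alpha q)) (T v))
    (hc : ∀ v, T (f (gamma q) v) = g (gamma q) (T v))
    (hc' : ∀ v, T (star (f (gamma q)) v) = star (g (gamma q)) (T v))
    (x : SUq q) : ∀ v, T (f x v) = g x (T v) := by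
  have hf := f.continuous_of_cstarAlgebra
  have hg := g.continuous_of_cstarAlgebra
  induction x using SUq.induction_on with
  | closed =>
    simp only [Set.ofPred_forall]
    exact isClosed_iInter fun v => isClosed_eq (by fun_prop) (by fun_prop)
  | one => simp
  | alpha_mul x hx => intro v; simp [ha, hx]
  | star_alpha_mul x hx => intro v; simp [ha', hx, map_star]
  | gamma_mul x hx => intro v; simp [hc, hx]
  | star_gamma_mul x hx => intro v; simp [hc', hx, map_star]
  | add x y hx hy => intro v; simp [hx, hy]
  | smul c x hx => intro v; simp [hx]

/-- An operator commuting with the generators and their adjoints commutes with the whole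
representation. -/
theorem commute_of_gen (f : SUq q →⋆ₐ[ℂ] (H →L[ℂ] H)) {T : H →L[ℂ] H}
    (ha : Commute T (f (alpha q))) (ha' : Commute T (star (f (alpha q))))
    (hc : Commute T (f (gamma q))) (hc' : Commute T (star (f (gamma q)))) (x : SUq q) :
    Commute T (f x) :=
  ContinuousLinearMap.ext (intertwines f f T (DFunLike.congr_fun ha.eq) (DFunLike.congr_fun ha'.eq)
    (DFunLike.congr_fun hc.eq) (DFunLike.congr_fun hc'.eq) x)

end intertwine

end SUq

/-! ### Schur's lemma and functional calculus -/

namespace HilbertRep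

universe u

variable {A : Type u} [CStarAlgebra A]

/-- Schur's lemma for normal operators. -/
theorem IsIrreducible.exists_eq_algebraMap {π : HilbertRep A} (hπ : π.IsIrreducible)
    (T : π.H →L[ℂ] π.H) [IsStarNormal T] (hT : ∀ x, Commute T (π.hom x)) :
    ∃ c : ℂ, T = algebraMap ℂ _ c := by
  have := hπ.1
  -- The image of `π` is closed under adjoints, so Fuglede's theorem is not needed.
  have hT' : ∀ x, Commute (star T) (π.hom x) := fun x => by
    have := (hT (star x)).star_star
    rwa [map_star, star_star] at this
  obtain ⟨z, hz⟩ := spectrum.nonempty T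
  by_cases hs : ∀ w ∈ spectrum ℂ T, w = z
  · refine ⟨z, ?_⟩
    conv_lhs => rw [← cfc_id ℂ T, cfc_congr (f := id) (g := fun _ => z) hs, cfc_const z T]
  · exfalso
    push Not at hs
    obtain ⟨w, hw, hwz⟩ := hs
    -- With two spectral points `z ≠ w`, `f` lives inside the disc of radius `δ` about `z` and `g`
    -- outside it. Then `f(T) g(T) = 0` while neither factor vanishes, so the kernel of `f(T)` is an
    -- invariant subspace that is neither zero nor everything.
    set δ : ℝ := ‖w - z‖ / 2 with hδ
    have hδ0 : 0 < δ := by have := norm_pos_iff.2 (sub_ne_zero.2 hwz); positivity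
    set f : ℂ → ℂ := fun t => ((max (δ - ‖t - z‖) 0 : ℝ) : ℂ) with hf
    set g : ℂ → ℂ := fun t => ((max (‖t - z‖ - δ) 0 : ℝ) : ℂ) with hg
    have hfc : Continuous f := by fun_prop
    have hgc : Continuous g := by fun_prop
    have hne : ∀ (h : ℂ → ℂ) (_ : Continuous h) (t : ℂ), t ∈ spectrum ℂ T → h t ≠ 0 →
        cfc h T ≠ 0 := by
      intro h hc t ht hht h0
      have := cfc_map_spectrum h T (hf := hc.continuousOn)
      rw [h0, spectrum.zero_eq] at this
      exact hht (this.ge ⟨t, ht, rfl⟩)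
    have hfg : cfc f T * cfc g T = 0 := by
      rw [← cfc_mul f g T hfc.continuousOn hgc.continuousOn, cfc_congr (g := fun _ => 0),
        cfc_const_zero]
      intro t _
      simp only [hf, hg]
      rcases le_total (‖t - z‖) δ with h | h
      · rw [max_eq_right (sub_nonpos.2 h)]; simp
      · rw [max_eq_right (a := δ - ‖t - z‖) (sub_nonpos.2 h)]; simp
    rcases hπ.2 ((cfc f T : π.H →L[ℂ] π.H).ker) (cfc f T).isClosed_ker
      (fun x v hv => by
        have h1 : cfc f T * π.hom x = π.hom x * cfc f T := ((hT x).cfc (hT' x) f).eq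
        have h2 := DFunLike.congr_fun h1 v
        have h3 : cfc f T v = 0 := hv
        change cfc f T (π.hom x v) = 0
        simpa [h3] using h2) with h | h
    · refine hne g hgc w hw ?_ (ContinuousLinearMap.ext fun v => ?_)
      · simp only [hg]
        rw [max_eq_left (by linarith)]
        exact_mod_cast (by linarith : ‖w - z‖ - δ ≠ 0)
      · have : cfc g T v ∈ (cfc f T : π.H →L[ℂ] π.H).ker :=
          DFunLike.congr_fun hfg v
        rw [h] at this
        exact this
    · refine hne f hfc z hz ?_ (ContinuousLinearMap.ext fun v => ?_)
      · simp only [hf, sub_self, norm_zero, sub_zero]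
        rw [max_eq_left hδ0.le]
        exact_mod_cast hδ0.ne'
      · have : v ∈ (cfc f T : π.H →L[ℂ] π.H).ker := by rw [h]; trivial
        exact this

/-- An isometric intertwiner from a non-zero Hilbert space into an irreducible representation is a
unitary equivalence. -/
theorem IsIrreducible.equivalent_of_isometry {π ρ : HilbertRep A} (hπ : π.IsIrreducible)
    [Nontrivial ρ.H] (T : ρ.H →ₗᵢ[ℂ] π.H) (hT : ∀ x v, T (ρ.hom x v) = π.hom x (T v)) :
    ρ.Equivalent π := by
  rcases hπ.2 (LinearMap.range T.toLinearMap) T.isometry.isClosedEmbedding.isClosed_range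
    (by rintro x _ ⟨v, rfl⟩; exact ⟨ρ.hom x v, hT x v⟩) with h | h
  · obtain ⟨v, hv⟩ := exists_ne (0 : ρ.H)
    have : T v ∈ LinearMap.range T.toLinearMap := ⟨v, rfl⟩
    rw [h, Submodule.mem_bot, map_eq_zero_iff T T.injective] at this
    exact absurd this hv
  · exact ⟨LinearIsometryEquiv.ofSurjective T (LinearMap.range_eq_top.1 h), hT⟩

end HilbertRep

/-- Star homomorphisms commute with the continuous functional calculus. A single element of the
algebra thereby realises the positive part of a scalar in many representations at once. -/
theorem StarAlgHom.map_cfc_max_zero {A B : Type*} [CStarAlgebra A] [CStarAlgebra B]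
    (f : A →⋆ₐ[ℂ] B) {s : A} (hs : IsSelfAdjoint s) {r : ℝ} (h : f s = algebraMap ℂ B r) :
    f (cfc (fun t : ℝ => max t 0) s) = algebraMap ℂ B (max r 0 : ℝ) := by
  have hr : ∀ t : ℝ, algebraMap ℂ B t = algebraMap ℝ B t := fun t =>
    (IsScalarTower.algebraMap_apply ℝ ℂ B t).symm
  rw [StarAlgHomClass.map_cfc (S := ℂ) f (fun t : ℝ => max t 0) s (by fun_prop)
    f.continuous_of_cstarAlgebra hs (hs.map f), h, hr, hr, cfc_algebraMap]

namespace SU2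

/-- Compactness makes the continuous matrix-valued functions on `SU(2)` a C*-algebra, and it bounds
distances to closed sets from below. -/
instance : CompactSpace SU2 := by
  refine isCompact_iff_compactSpace.1 (Metric.isCompact_of_isClosed_isBounded ?_ ?_)
  · exact isClosed_eq (by fun_prop) continuous_const
  · refine (Metric.isBounded_iff_subset_closedBall 0).2 ⟨1, fun x hx => ?_⟩
    have hx : ‖x.1‖ ^ 2 + ‖x.2‖ ^ 2 = 1 := hx
    rw [mem_closedBall_zero_iff, Prod.norm_def, max_le_iff]
    constructor <;> nlinarith [sq_nonneg ‖x.1‖, sq_nonneg ‖x.2‖, norm_nonneg x.1, norm_nonneg x.2]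

@[fun_prop] theorem continuous_a : Continuous a := continuous_fst.comp continuous_subtype_val
@[fun_prop] theorem continuous_c : Continuous c := continuous_snd.comp continuous_subtype_val

theorem ext_ac {x y : SU2} (ha : x.a = y.a) (hc : x.c = y.c) : x = y := Subtype.ext (Prod.ext ha hc)

/-! ### The family of two-dimensional representations -/

/-- The two-dimensional representation `α ↦ diag(a, -a)`, `γ ↦ antidiag(c, c)`, for every point. -/
noncomputable def twoDim (x : SU2) : SUq (-1) →⋆ₐ[ℂ] (C2 →L[ℂ] C2) := SUq.lift _ _ (rel_two_dim x)

theorem twoDim_alpha (x : SU2) : x.twoDim (SUq.alpha (-1)) = op !![x.a, 0; 0, -x.a] :=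
  SUq.lift_alpha _ _ _

theorem twoDim_gamma (x : SU2) : x.twoDim (SUq.gamma (-1)) = op !![0, x.c; x.c, 0] :=
  SUq.lift_gamma _ _ _

theorem star_op (M : Matrix (Fin 2) (Fin 2) ℂ) : star (op M) = op (star M) :=
  (map_star (Matrix.toEuclideanCLM (𝕜 := ℂ) (n := Fin 2)) M).symm

theorem star_twoDim_alpha (x : SU2) :
    star (x.twoDim (SUq.alpha (-1))) = op !![star x.a, 0; 0, -star x.a] := by
  rw [twoDim_alpha, star_op]
  congr 1
  ext i j; fin_cases i <;> fin_cases j <;> simp [Matrix.star_apply]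

theorem star_twoDim_gamma (x : SU2) :
    star (x.twoDim (SUq.gamma (-1))) = op !![0, star x.c; star x.c, 0] := by
  rw [twoDim_gamma, star_op]
  congr 1
  ext i j; fin_cases i <;> fin_cases j <;> simp [Matrix.star_apply]

theorem continuous_op : Continuous op :=
  ((Matrix.toEuclideanCLM (𝕜 := ℂ) (n := Fin 2)).toAlgEquiv.toLinearEquiv.toLinearMap
    ).continuous_of_finiteDimensional

/-- The matrices of `α` and `γ`, as functions of `x`, satisfy the relations in the C*-algebra of
continuous operator-valued functions on `SU(2)`. The universal property sends `s` to such a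
function, and by uniqueness its value at `x` is `x.twoDim s`. -/
theorem continuous_twoDim_apply (s : SUq (-1)) : Continuous fun x : SU2 => x.twoDim s := by
  let A : C(SU2, C2 →L[ℂ] C2) :=
    ⟨fun x => op !![x.a, 0; 0, -x.a], continuous_op.comp (by fun_prop)⟩
  let C : C(SU2, C2 →L[ℂ] C2) :=
    ⟨fun x => op !![0, x.c; x.c, 0], continuous_op.comp (by fun_prop)⟩
  have hr : SUqRel (-1) A C := by
    constructor <;> refine ContinuousMap.ext fun x => ?_
    exacts [(rel_two_dim x).rel_one, (rel_two_dim x).rel_two, (rel_two_dim x).rel_three,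
      (rel_two_dim x).rel_four, (rel_two_dim x).rel_five]
  let E (x : SU2) : C(SU2, C2 →L[ℂ] C2) →⋆ₐ[ℂ] (C2 →L[ℂ] C2) :=
    { toFun := fun f => f x
      map_one' := rfl
      map_mul' := fun _ _ => rfl
      map_zero' := rfl
      map_add' := fun _ _ => rfl
      commutes' := fun _ => rfl
      map_star' := fun _ => rfl }
  have h : ∀ x : SU2, x.twoDim s = SUq.lift A C hr s x := fun x => by
    have : x.twoDim = (E x).comp (SUq.lift A C hr) := by
      apply SUq.hom_ext
      · simp only [twoDim_alpha, StarAlgHom.comp_apply, SUq.lift_alpha]; rfl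
      · simp only [twoDim_gamma, StarAlgHom.comp_apply, SUq.lift_gamma]; rfl
    rw [this]; rfl
  simp only [h]
  exact (SUq.lift A C hr s).continuous

theorem rep_of_eq (x : SU2) (h : x.a * x.c = 0) :
    x.rep = { H := ℂ, hom := SUq.lift _ _ (rel_one_dim x h) } := dif_pos h

theorem rep_alpha_of_eq {x : SU2} (h : x.a * x.c = 0) :
    x.rep.hom (SUq.alpha (-1)) = algebraMap ℂ _ x.a := by
  rw [rep_of_eq x h, SUq.lift_alpha, Algebra.algebraMap_eq_smul_one]

theorem rep_gamma_of_eq {x : SU2} (h : x.a * x.c = 0) :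
    x.rep.hom (SUq.gamma (-1)) = algebraMap ℂ _ x.c := by
  rw [rep_of_eq x h, SUq.lift_gamma, Algebra.algebraMap_eq_smul_one]

theorem rep_hom_eq_zero_iff_of_ne {x : SU2} (h : x.a * x.c ≠ 0) (s : SUq (-1)) :
    x.rep.hom s = 0 ↔ x.twoDim s = 0 := by
  rw [rep_of_ne x h]; rfl

/-- A one-dimensional `π_{(a,c)}` is the restriction of the two-dimensional representation to the
line spanned by a common eigenvector. -/
theorem rep_hom_eq_zero_iff_of_eigenvector {x : SU2} (h : x.a * x.c = 0) {v : C2} (hv : v ≠ 0)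
    (ha : op !![x.a, 0; 0, -x.a] v = x.a • v)
    (ha' : op !![star x.a, 0; 0, -star x.a] v = star x.a • v)
    (hc : op !![0, x.c; x.c, 0] v = x.c • v)
    (hc' : op !![0, star x.c; star x.c, 0] v = star x.c • v) (s : SUq (-1)) :
    x.rep.hom s = 0 ↔ x.twoDim s v = 0 := by
  simp only [RCLike.star_def] at ha' hc'
  rw [rep_of_eq x h]
  set f := SUq.lift _ _ (rel_one_dim x h) with hf
  change f s = 0 ↔ _
  have key := SUq.intertwines f x.twoDim (ContinuousLinearMap.toSpanSingleton ℂ v)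
    (fun z => by
      simp [hf, twoDim_alpha, -Matrix.toEuclideanCLM_toLp, ha, smul_smul, mul_comm])
    (fun z => by
      simp [hf, star_twoDim_alpha, -Matrix.toEuclideanCLM_toLp, ha', smul_smul, mul_comm])
    (fun z => by
      simp [hf, twoDim_gamma, -Matrix.toEuclideanCLM_toLp, hc, smul_smul, mul_comm])
    (fun z => by
      simp [hf, star_twoDim_gamma, -Matrix.toEuclideanCLM_toLp, hc', smul_smul, mul_comm]) s 1
  simp only [ContinuousLinearMap.toSpanSingleton_apply, one_smul] at key
  rw [← key, smul_eq_zero, or_iff_left hv]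
  exact ⟨fun h => by rw [h]; rfl, fun h => ContinuousLinearMap.ext_ring h⟩

/-- Here `γ` acts by zero and the first basis vector is an eigenvector of `diag(a, -a)`. -/
theorem rep_hom_eq_zero_iff_of_c_eq_zero {x : SU2} (h : x.c = 0) (s : SUq (-1)) :
    x.rep.hom s = 0 ↔ x.twoDim s !₂[1, 0] = 0 := by
  refine rep_hom_eq_zero_iff_of_eigenvector (by simp [h])
    (fun h0 => by simpa using congrArg (fun u : C2 => u 0) h0) ?_ ?_ ?_ ?_ s <;>
  · ext i; fin_cases i <;> simp [h]

/-- Here `α` acts by zero and the flip matrix fixes `(1, 1)`. -/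
theorem rep_hom_eq_zero_iff_of_a_eq_zero {x : SU2} (h : x.a = 0) (s : SUq (-1)) :
    x.rep.hom s = 0 ↔ x.twoDim s !₂[1, 1] = 0 := by
  refine rep_hom_eq_zero_iff_of_eigenvector (by simp [h])
    (fun h0 => by simpa using congrArg (fun u : C2 => u 0) h0) ?_ ?_ ?_ ?_ s <;>
  · ext i; fin_cases i <;> simp [h]

/-- The first set of the union need not be restricted to `ac ≠ 0`: if the two-dimensional operator
vanishes at a point with `ac = 0`, so does its restriction to the eigenline. -/
theorem isClosed_setOf_rep_hom_eq_zero (s : SUq (-1)) : IsClosed {x : SU2 | x.rep.hom s = 0} := by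
  have hs := continuous_twoDim_apply s
  have h : {x : SU2 | x.rep.hom s = 0} = {x | x.twoDim s = 0} ∪
      ({x | x.c = 0 ∧ x.twoDim s !₂[1, 0] = 0} ∪ {x | x.a = 0 ∧ x.twoDim s !₂[1, 1] = 0}) := by
    ext x
    simp only [Set.mem_ofPred_eq, Set.mem_union]
    by_cases hc : x.c = 0
    · rw [rep_hom_eq_zero_iff_of_c_eq_zero hc]
      constructor
      · exact fun h => Or.inr (Or.inl ⟨hc, h⟩)
      · rintro (h | h | h)
        · rw [h]; rfl
        · exact h.2
        · exact absurd x.2 (by simp [show x.1.2 = 0 from hc, show x.1.1 = 0 from h.1])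
    by_cases ha : x.a = 0
    · rw [rep_hom_eq_zero_iff_of_a_eq_zero ha]
      constructor
      · exact fun h => Or.inr (Or.inr ⟨ha, h⟩)
      · rintro (h | h | h)
        · rw [h]; rfl
        · exact absurd h.1 hc
        · exact h.2
    · rw [rep_hom_eq_zero_iff_of_ne (mul_ne_zero ha hc)]
      simp [ha, hc]
  rw [h]
  exact (isClosed_eq hs continuous_const).union
    (((isClosed_eq continuous_c continuous_const).inter
      (isClosed_eq (hs.clm_apply continuous_const) continuous_const)).union
    ((isClosed_eq continuous_a continuous_const).inter
      (isClosed_eq (hs.clm_apply continuous_const) continuous_const)))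

/-! ### Separating a point from a closed set -/

/-- The opposite signs in `diag(a, -a)` disappear on squaring, so both kinds of representation give
the same scalar. -/
theorem rep_alpha_mul_alpha (x : SU2) :
    x.rep.hom (SUq.alpha (-1) * SUq.alpha (-1)) = algebraMap ℂ _ (x.a * x.a) := by
  by_cases h : x.a * x.c = 0
  · rw [map_mul, rep_alpha_of_eq h, map_mul]
  · rw [rep_of_ne x h, map_mul, SUq.lift_alpha]
    ext v i; fin_cases i <;>
      simp [Algebra.algebraMap_eq_smul_one, Matrix.vecHead, Matrix.vecTail, mul_assoc] <;>
      exact Or.inl (mul_comm _ _)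

theorem rep_gamma_mul_gamma (x : SU2) :
    x.rep.hom (SUq.gamma (-1) * SUq.gamma (-1)) = algebraMap ℂ _ (x.c * x.c) := by
  by_cases h : x.a * x.c = 0
  · rw [map_mul, rep_gamma_of_eq h, map_mul]
  · rw [rep_of_ne x h, map_mul, SUq.lift_gamma]
    ext v i; fin_cases i <;>
      simp [Algebra.algebraMap_eq_smul_one, Matrix.vecHead, Matrix.vecTail, mul_assoc] <;>
      exact Or.inl (mul_comm _ _)

/-- The squared distance of the points `(a², c²)` belonging to two points `(a, c)` of `SU(2)`. -/
noncomputable def sqDist (y x : SU2) : ℝ :=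
  Complex.normSq (x.a * x.a - y.a * y.a) + Complex.normSq (x.c * x.c - y.c * y.c)

theorem continuous_sqDist (y : SU2) : Continuous (sqDist y) := by
  unfold sqDist
  have := Complex.continuous_normSq
  fun_prop

theorem sqDist_nonneg (y x : SU2) : 0 ≤ sqDist y x :=
  add_nonneg (Complex.normSq_nonneg _) (Complex.normSq_nonneg _)

theorem sqDist_self (y : SU2) : sqDist y y = 0 := by simp [sqDist]

theorem sqDist_r_s (y x : SU2) : sqDist y x.r.s = sqDist y x := by simp [sqDist, r, s, a, c]

theorem mem_orbit_of_sqDist_eq_zero {y x : SU2} (h : sqDist y x = 0) : x ∈ y.orbit := by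
  have h1 := (add_eq_zero_iff_of_nonneg (Complex.normSq_nonneg _) (Complex.normSq_nonneg _)).1 h
  rw [Complex.normSq_eq_zero, Complex.normSq_eq_zero, sub_eq_zero, sub_eq_zero, mul_self_eq_mul_self_iff,
    mul_self_eq_mul_self_iff] at h1
  rw [mem_orbit]
  rcases h1 with ⟨ha | ha, hc | hc⟩
  · exact Or.inl (ext_ac ha hc)
  · exact Or.inr (Or.inr (Or.inl (ext_ac ha hc)))
  · exact Or.inr (Or.inl (ext_ac ha hc))
  · exact Or.inr (Or.inr (Or.inr (ext_ac ha hc)))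

/-- `sqDist y` vanishes only on the orbit of `y`, and it attains its minimum on the compact set `F`.
-/
theorem exists_pos_le_sqDist {y : SU2} {F : Set SU2} (hF : IsClosed F)
    (h : ∀ x ∈ F, x ∉ y.orbit) : ∃ ε > 0, ∀ x ∈ F, ε ≤ sqDist y x := by
  rcases F.eq_empty_or_nonempty with rfl | hne
  · exact ⟨1, one_pos, by simp⟩
  · obtain ⟨x, hx, hmin⟩ := hF.isCompact.exists_isMinOn hne (continuous_sqDist y).continuousOn
    exact ⟨sqDist y x, (sqDist_nonneg y x).lt_of_ne fun h0 =>
      h x hx (mem_orbit_of_sqDist_eq_zero h0.symm), fun z hz => hmin hz⟩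

/-- An element of `C(SU_{-1}(2))` acting in every `π_{(a,c)}` as a scalar, namely as a bump function
around the orbit of `y`. -/
theorem exists_rep_hom_eq_bump (y : SU2) (ε : ℝ) : ∃ z : SUq (-1), ∀ x : SU2,
    x.rep.hom z = algebraMap ℂ _ (max (ε - sqDist y x) 0 : ℝ) := by
  set u := SUq.alpha (-1) * SUq.alpha (-1) - algebraMap ℂ _ (y.a * y.a) with hu
  set w := SUq.gamma (-1) * SUq.gamma (-1) - algebraMap ℂ _ (y.c * y.c) with hw
  -- This element acts in `π_x` as `ε - sqDist y x`; the witness is its positive part.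
  have hsa : IsSelfAdjoint (algebraMap ℂ (SUq (-1)) (ε : ℂ) - (star u * u + star w * w)) := by
    refine .sub ?_ ((IsSelfAdjoint.star_mul_self u).add (.star_mul_self w))
    rw [isSelfAdjoint_iff, ← algebraMap_star_comm]
    simp
  refine ⟨_, fun x => StarAlgHom.map_cfc_max_zero x.rep.hom hsa ?_⟩
  have h1 : x.rep.hom u = algebraMap ℂ _ (x.a * x.a - y.a * y.a) := by
    rw [hu, map_sub, rep_alpha_mul_alpha, AlgHomClass.commutes, ← map_sub]
  have h2 : x.rep.hom w = algebraMap ℂ _ (x.c * x.c - y.c * y.c) := by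
    rw [hw, map_sub, rep_gamma_mul_gamma, AlgHomClass.commutes, ← map_sub]
  rw [map_sub, map_add, map_mul, map_mul, map_star, map_star, h1, h2, AlgHomClass.commutes,
    ← algebraMap_star_comm, ← algebraMap_star_comm, ← map_mul, ← map_mul, ← map_add, ← map_sub]
  congr 1
  simp only [sqDist, Complex.ofReal_sub, Complex.ofReal_add, Complex.normSq_eq_conj_mul_self]
  rfl

/-- For `x` with `ac = 0`, `π_x` detects the real inner product of `x` with `y`. -/
theorem exists_rep_hom_eq_re_inner (y : SU2) : ∃ k : SUq (-1), ∀ x : SU2, x.a * x.c = 0 →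
    x.rep.hom k = algebraMap ℂ _ (max (star y.a * x.a + star y.c * x.c).re 0 : ℝ) := by
  set k := star y.a • SUq.alpha (-1) + star y.c • SUq.gamma (-1) with hk
  have hsa : IsSelfAdjoint ((2⁻¹ : ℝ) • (k + star k)) :=
    (IsSelfAdjoint.all _).smul (IsSelfAdjoint.add_star_self k)
  refine ⟨_, fun x hx => StarAlgHom.map_cfc_max_zero x.rep.hom hsa ?_⟩
  have h1 : x.rep.hom k = algebraMap ℂ _ (star y.a * x.a + star y.c * x.c) := by
    rw [hk, map_add, map_smul, map_smul, rep_alpha_of_eq hx, rep_gamma_of_eq hx, map_add, map_mul,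
      map_mul, ← Algebra.smul_def, ← Algebra.smul_def]
  have h2 : (2⁻¹ : ℝ) • (k + star k) = (2⁻¹ : ℂ) • (k + star k) := by
    rw [← Complex.coe_smul]; simp
  rw [h2, map_smul, map_add, map_star, h1, ← algebraMap_star_comm, ← map_add, Algebra.smul_def,
    ← map_mul]
  congr 1
  rw [Complex.star_def, Complex.add_conj]
  push_cast
  ring

/-- A bump around the orbit of `y` works when `ac ≠ 0` at `y`, since then the whole orbit is
equivalent to `y` and avoids `F`. When `ac = 0`, `F` may contain `-y`, and the bump is multiplied by
the positive part of the inner product with `y`. -/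
theorem exists_separating {F : Set SU2} (hF : IsClosed F)
    (hsat : ∀ x ∈ F, ∀ y, Rel x y → y ∈ F) {y : SU2} (hy : y ∉ F) :
    ∃ s : SUq (-1), (∀ x ∈ F, x.rep.hom s = 0) ∧ y.rep.hom s ≠ 0 := by
  have := y.rep_irreducible.1
  have hy' : ∀ x ∈ F, ¬ Rel y x := fun x hx h => hy (hsat x hx y (setoid.symm h))
  by_cases h : y.a * y.c = 0
  · set t : SU2 → ℝ := fun x => (star y.a * x.a + star y.c * x.c).re with ht
    have htc : Continuous t := by fun_prop
    have hty : t y = 1 := by simp only [ht, normSq, Complex.one_re]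
    -- The orbit is `{y, -y}`: `y` is not in `F`, and `t (-y) = -1` excludes `-y` from the half `0 ≤
    -- t`. Hence every point of `F` closer than `ε` has `t < 0`.
    obtain ⟨ε, hε, hεF⟩ := exists_pos_le_sqDist (y := y)
      (hF.inter (isClosed_le continuous_const htc : IsClosed {x | 0 ≤ t x})) (by
        rintro x ⟨hx, hxt : 0 ≤ t x⟩ hxy
        have hneg : t y.r.s = -1 := by
          rw [← hty]; simp [ht, r, s, a, c]; ring
        rcases mul_eq_zero.1 h with h0 | h0
        · have hr : y.r = y := ext_ac (by simp [r, a, show y.1.1 = 0 from h0]) rfl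
          rw [mem_orbit, hr] at hxy
          rw [hr] at hneg
          rcases hxy with rfl | rfl | rfl | rfl
          · exact hy hx
          · exact hy hx
          · linarith
          · linarith
        · have hs : ∀ z : SU2, z.c = 0 → z.s = z := fun z hz =>
            ext_ac rfl (by simp [s, c, show z.1.2 = 0 from hz])
          have hs1 := hs y h0
          have hs2 := hs y.r h0
          rw [mem_orbit, hs1, hs2] at hxy
          rw [hs2] at hneg
          rcases hxy with rfl | rfl | rfl | rfl
          · exact hy hx
          · linarith
          · exact hy hx
          · linarith)
    obtain ⟨z, hz⟩ := exists_rep_hom_eq_bump y ε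
    obtain ⟨k, hk⟩ := exists_rep_hom_eq_re_inner y
    refine ⟨z * k, fun x hx => ?_, ?_⟩
    · rw [map_mul]
      rcases le_or_gt ε (sqDist y x) with hd | hd
      · rw [hz, max_eq_right (sub_nonpos.2 hd), Complex.ofReal_zero, map_zero, zero_mul]
      have hlt : ∀ x ∈ F, sqDist y x < ε → t x < 0 := fun x hx hd => by
        by_contra! h0
        exact (hεF x ⟨hx, h0⟩).not_gt hd
      -- If `ac ≠ 0` at `x`, saturation puts `-x` into `F`, at the same `sqDist` from `y`. Then both
      -- `t x` and `-t x` would be negative.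
      have hxs : x.a * x.c = 0 := by
        by_contra hne
        have h1 := hlt x hx hd
        have h2 := hlt x.r.s (hsat x hx _ (Or.inr ⟨hne, by simp [mem_orbit]⟩))
          (by rwa [sqDist_r_s])
        have h3 : t x.r.s = -t x := by simp [ht, r, s, a, c]; ring
        linarith
      rw [hk x hxs, max_eq_right (hlt x hx hd).le, Complex.ofReal_zero, map_zero, mul_zero]
    · rw [map_mul, hz, hk y h, sqDist_self, ← map_mul, ← Complex.ofReal_mul]
      have : (star y.a * y.a + star y.c * y.c).re = 1 := hty
      rw [this, sub_zero, max_eq_left hε.le, max_eq_left zero_le_one, mul_one]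
      simpa using hε.ne'
  · obtain ⟨ε, hε, hεF⟩ := exists_pos_le_sqDist hF fun x hx hxy => hy' x hx (Or.inr ⟨h, hxy⟩)
    obtain ⟨z, hz⟩ := exists_rep_hom_eq_bump y ε
    refine ⟨z, fun x hx => ?_, ?_⟩
    · rw [hz, max_eq_right (sub_nonpos.2 (hεF x hx)), Complex.ofReal_zero, map_zero]
    · rw [hz, sqDist_self, sub_zero, max_eq_left hε.le]
      simpa using hε.ne'

end SU2

/-! ### Classification of the irreducible representations -/

/-- The two signs cancel; this makes `α²`, `γ²` and `α*α` central. -/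
theorem commute_mul_of_anticommute {R : Type*} [Ring R] {x y z : R} (hx : x * z = -(z * x))
    (hy : y * z = -(z * y)) : Commute (x * y) z := by
  rw [Commute, SemiconjBy, mul_assoc, hy, mul_neg, ← mul_assoc, hx, neg_mul, neg_neg, mul_assoc]

namespace SUqRel

variable {B : Type*} [Ring B] [StarRing B] [Algebra ℂ B] {a c : B}

theorem mul_eq_neg (h : SUqRel (-1) a c) : a * c = -(c * a) := by simpa using h.rel_three

theorem mul_star_eq_neg (h : SUqRel (-1) a c) : a * star c = -(star c * a) := by
  simpa using h.rel_four

theorem star_mul_eq_neg (h : SUqRel (-1) a c) : star a * c = -(c * star a) := by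
  have := congrArg star h.mul_star_eq_neg
  rw [star_neg, star_mul, star_mul, star_star] at this
  rw [this, neg_neg]

theorem star_mul_star_eq_neg (h : SUqRel (-1) a c) : star a * star c = -(star c * star a) := by
  have := congrArg star h.mul_eq_neg
  rw [star_neg, star_mul, star_mul] at this
  rw [this, neg_neg]

/-- Since `q² = 1` and `c` is normal, the first two relations differ only in the order of `a` and
`a*`. -/
theorem isStarNormal_left (h : SUqRel (-1) a c) : IsStarNormal a := by
  refine ⟨?_⟩
  have h1 := h.rel_one
  have h2 := h.rel_two
  rw [h.rel_five] at h2
  simp only [Complex.ofReal_neg, Complex.ofReal_one, even_two, Even.neg_pow, one_pow, one_smul]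
    at h2
  exact add_right_cancel (h1.trans h2.symm)

theorem isStarNormal_right (h : SUqRel (-1) a c) : IsStarNormal c := ⟨h.rel_five.symm⟩

end SUqRel

open scoped InnerProductSpace

/-- Anticommuting non-zero operators `A`, `C` with scalar `A²`, `C²`, `A*A`, `C*C` and
`A*A + C*C = 1` act on some plane as `α` and `γ` do in a two-dimensional representation. -/
theorem SU2.exists_plane {H : Type*} [NormedAddCommGroup H] [InnerProductSpace ℂ H]
    [CompleteSpace H] {A C : H →L[ℂ] H} (hAC : A * C = -(C * A)) (hA : A ≠ 0) (hC : C ≠ 0)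
    {l m p q : ℂ} (hl : A * A = algebraMap ℂ _ l) (hm : C * C = algebraMap ℂ _ m)
    (hp : star A * A = algebraMap ℂ _ p) (hq : star C * C = algebraMap ℂ _ q) (hpq : p + q = 1) :
    ∃ (x : SU2) (v w : H), x.a * x.c ≠ 0 ∧ ‖v‖ = 1 ∧ ‖w‖ = 1 ∧ ⟪v, w⟫_ℂ = 0 ∧
      (A v = x.a • v ∧ A w = -(x.a • w)) ∧ (star A v = star x.a • v ∧ star A w = -(star x.a • w)) ∧
      (C v = x.c • w ∧ C w = x.c • v) ∧ (star C v = star x.c • w ∧ star C w = star x.c • v) := by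
  have hl' : ∀ u, A (A u) = l • u := fun u => by
    simpa [Algebra.algebraMap_eq_smul_one] using DFunLike.congr_fun hl u
  have hm' : ∀ u, C (C u) = m • u := fun u => by
    simpa [Algebra.algebraMap_eq_smul_one] using DFunLike.congr_fun hm u
  have hp' : ∀ u, star A (A u) = p • u := fun u => by
    simpa [Algebra.algebraMap_eq_smul_one] using DFunLike.congr_fun hp u
  have hq' : ∀ u, star C (C u) = q • u := fun u => by
    simpa [Algebra.algebraMap_eq_smul_one] using DFunLike.congr_fun hq u
  have hAC' : ∀ u, A (C u) = -C (A u) := fun u => by simpa using DFunLike.congr_fun hAC u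
  have hpin : ∀ u w, ⟪A u, A w⟫_ℂ = p * ⟪u, w⟫_ℂ := fun u w => by
    rw [← ContinuousLinearMap.adjoint_inner_right, ← ContinuousLinearMap.star_eq_adjoint, hp',
      inner_smul_right]
  have hqin : ∀ u w, ⟪C u, C w⟫_ℂ = q * ⟪u, w⟫_ℂ := fun u w => by
    rw [← ContinuousLinearMap.adjoint_inner_right, ← ContinuousLinearMap.star_eq_adjoint, hq',
      inner_smul_right]
  have hp0 : p ≠ 0 := by
    rintro rfl
    rw [map_zero, CStarRing.star_mul_self_eq_zero_iff] at hp
    exact hA hp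
  have hq0 : q ≠ 0 := by
    rintro rfl
    rw [map_zero, CStarRing.star_mul_self_eq_zero_iff] at hq
    exact hC hq
  obtain ⟨a, rfl⟩ := IsAlgClosed.exists_eq_mul_self l
  obtain ⟨c, rfl⟩ := IsAlgClosed.exists_eq_mul_self m
  obtain ⟨v, hv1, hAv⟩ : ∃ v : H, ‖v‖ = 1 ∧ A v = a • v := by
    -- As `(A - a)(A + a) = 0`, any non-zero value of `A + a` is an eigenvector for `a`. If `A + a`
    -- were zero, `A` would be a scalar anticommuting with `C`, forcing `2aC = 0`.
    obtain ⟨u, hu⟩ : ∃ u, A u + a • u ≠ 0 := by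
      by_contra! hall
      have hA' : ∀ u, A u = -(a • u) := fun u => eq_neg_of_add_eq_zero_left (hall u)
      refine hC (ContinuousLinearMap.ext fun u => ?_)
      have h1 := hAC' u
      rw [hA', hA', map_neg, map_smul, neg_neg] at h1
      have h2 : (2 * a) • C u = 0 := by
        rw [two_mul, add_smul]; nth_rw 1 [← h1]; exact neg_add_cancel _
      rw [smul_eq_zero, mul_eq_zero, or_iff_right two_ne_zero] at h2
      rcases h2 with rfl | h2
      · exact absurd (ContinuousLinearMap.ext fun u => by simpa using hA' u) hA
      · exact h2
    refine ⟨((‖A u + a • u‖⁻¹ : ℝ) : ℂ) • (A u + a • u), ?_, ?_⟩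
    · rw [norm_smul, Complex.norm_real, norm_inv, norm_norm, inv_mul_cancel₀ (norm_ne_zero_iff.2 hu)]
    · have : A (A u + a • u) = a • (A u + a • u) := by
        rw [map_add, map_smul, hl', smul_add, smul_smul, add_comm]
      rw [map_smul, this, smul_comm]
  have hvv : ⟪v, v⟫_ℂ = 1 := by rw [inner_self_eq_norm_sq_to_K, hv1]; simp
  have hpa : p = star a * a := by
    have := hpin v v
    rw [hAv, inner_smul_left, inner_smul_right, hvv, mul_one, mul_one] at this
    exact this.symm
  have ha0 : a ≠ 0 := by rintro rfl; simp [hp0] at hpa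
  have hCn : (‖C v‖ : ℂ) ^ 2 = q := by
    have := hqin v v
    rw [hvv, mul_one, inner_self_eq_norm_sq_to_K] at this
    exact this
  -- `C` scales squared norms by `q = ‖Cv‖²`. Applied to `Cv`, with `C²v = c²v`, this gives `|c|⁴ =
  -- ‖Cv‖⁴`.
  have hcn : ‖C v‖ = ‖c‖ := by
    have h1 : ((‖c‖ * ‖c‖ : ℝ) : ℂ) ^ 2 = (‖C v‖ : ℂ) ^ 2 * (‖C v‖ : ℂ) ^ 2 := by
      have := hqin (C v) (C v)
      rw [hm', ← hCn, inner_self_eq_norm_sq_to_K, inner_self_eq_norm_sq_to_K, norm_smul, norm_mul,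
        hv1, mul_one] at this
      exact this
    have h2 : (‖c‖ * ‖c‖) ^ 2 = ‖C v‖ ^ 2 * ‖C v‖ ^ 2 := by exact_mod_cast h1
    have h3 := norm_nonneg c
    have h4 := norm_nonneg (C v)
    have h5 : (‖c‖ ^ 2) ^ 2 = (‖C v‖ ^ 2) ^ 2 := by linear_combination h2
    have h6 := (pow_left_inj₀ (sq_nonneg _) (sq_nonneg _) two_ne_zero).1 h5
    exact ((pow_left_inj₀ h3 h4 two_ne_zero).1 h6).symm
  have hqc : q = star c * c := by
    rw [← hCn, hcn]; exact (Complex.conj_mul' c).symm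
  have hc0 : c ≠ 0 := by rintro rfl; simp [hq0] at hqc
  have hx : ‖a‖ ^ 2 + ‖c‖ ^ 2 = 1 := by
    rw [hpa, hqc] at hpq
    have : (starRingEnd ℂ) a * a + (starRingEnd ℂ) c * c = 1 := hpq
    rw [Complex.conj_mul', Complex.conj_mul'] at this
    exact_mod_cast this
  obtain ⟨w, hCv⟩ : ∃ w, C v = c • w := ⟨c⁻¹ • C v, by rw [smul_inv_smul₀ hc0]⟩
  have hCw : C w = c • v := by
    have := hm' v
    rw [hCv, map_smul, mul_smul] at this
    exact smul_right_injective H hc0 this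
  have hAw : A w = -(a • w) := by
    have := hAC' v
    rw [hAv, map_smul, hCv, map_smul, smul_comm a, ← smul_neg] at this
    exact smul_right_injective H hc0 this
  -- The adjoints come from `A*A = |a|²` and `C*C = |c|²` by cancelling the non-zero factor `a` or
  -- `c`.
  have hAv' : star A v = star a • v := by
    have := hp' v
    rw [hAv, map_smul, hpa, mul_comm, mul_smul] at this
    exact smul_right_injective H ha0 this
  have hAw' : star A w = -(star a • w) := by
    have := hp' w
    rw [hAw, map_neg, map_smul, hpa, mul_comm, mul_smul, neg_eq_iff_eq_neg, ← smul_neg] at this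
    exact smul_right_injective H ha0 this
  have hCv' : star C v = star c • w := by
    have := hq' w
    rw [hCw, map_smul, hqc, mul_comm, mul_smul] at this
    exact smul_right_injective H hc0 this
  have hCw' : star C w = star c • v := by
    have := hq' v
    rw [hCv, map_smul, hqc, mul_comm, mul_smul] at this
    exact smul_right_injective H hc0 this
  refine ⟨⟨(a, c), hx⟩, v, w, mul_ne_zero ha0 hc0, hv1, ?_, ?_, ⟨hAv, hAw⟩, ⟨hAv', hAw'⟩,
    ⟨hCv, hCw⟩, ⟨hCv', hCw'⟩⟩
  · rw [hCv, norm_smul] at hcn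
    exact (mul_eq_left₀ (norm_ne_zero_iff.2 hc0)).1 hcn
  -- The eigenvalues `a` and `-a` give `⟪Av, Aw⟫ = -|a|²⟪v, w⟫`, whereas `A*A = |a|²` gives the
  -- opposite sign.
  · have := hpin v w
    rw [hAv, hAw, inner_smul_left, inner_neg_right, inner_smul_right] at this
    have h2 : (2 * p) * ⟪v, w⟫_ℂ = 0 := by
      have h3 : p = (starRingEnd ℂ) a * a := hpa
      linear_combination -this + ⟪v, w⟫_ℂ * h3
    exact (mul_eq_zero.1 h2).resolve_left (mul_ne_zero two_ne_zero hp0)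

/-- The isometric embedding of `ℂ²` given by two orthogonal unit vectors. -/
noncomputable def SU2.planeEmbedding {H : Type*} [NormedAddCommGroup H] [InnerProductSpace ℂ H] {v w : H}
    (hv : ‖v‖ = 1) (hw : ‖w‖ = 1) (hvw : ⟪v, w⟫_ℂ = 0) : C2 →ₗᵢ[ℂ] H where
  toFun u := u 0 • v + u 1 • w
  map_add' u u' := by simp only [PiLp.add_apply, add_smul]; abel
  map_smul' k u := by simp [smul_smul]
  norm_map' u := by
    refine (pow_left_inj₀ (norm_nonneg _) (norm_nonneg _) two_ne_zero).1 ?_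
    change ‖u 0 • v + u 1 • w‖ ^ 2 = _
    rw [norm_add_sq (𝕜 := ℂ), EuclideanSpace.norm_sq_eq, Fin.sum_univ_two, inner_smul_left,
      inner_smul_right, hvw, norm_smul, norm_smul, hv, hw]
    simp

namespace SU2

variable {π : HilbertRep (SUq (-1))}

/-- When both generators are scalars, the line through any unit vector carries the character, and
irreducibility makes it the whole space. -/
theorem exists_rep_equivalent_of_scalar (hπ : π.IsIrreducible) {a c : ℂ}
    (ha : π.hom (SUq.alpha (-1)) = algebraMap ℂ _ a) (hc : π.hom (SUq.gamma (-1)) = algebraMap ℂ _ c)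
    (hac : a * c = 0) : ∃ x : SU2, x.rep.Equivalent π := by
  have := hπ.1
  have hr := ((SUq.rel (-1)).map π.hom).rel_one
  rw [ha, hc, ← algebraMap_star_comm, ← algebraMap_star_comm, ← map_mul, ← map_mul, ← map_add,
    ← map_one (algebraMap ℂ (π.H →L[ℂ] π.H))] at hr
  have hx : ‖a‖ ^ 2 + ‖c‖ ^ 2 = 1 := by
    have : (starRingEnd ℂ) a * a + (starRingEnd ℂ) c * c = 1 := FaithfulSMul.algebraMap_injective _ _ hr
    rw [Complex.conj_mul', Complex.conj_mul'] at this
    exact_mod_cast this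
  obtain ⟨v, hv⟩ := exists_norm_eq π.H zero_le_one
  refine ⟨⟨(a, c), hx⟩, ?_⟩
  rw [rep_of_eq ⟨(a, c), hx⟩ hac]
  refine hπ.equivalent_of_isometry (ρ := ⟨ℂ, _⟩) (LinearIsometry.toSpanSingleton ℂ π.H hv) ?_
  refine SUq.intertwines _ _ (LinearIsometry.toSpanSingleton ℂ π.H hv).toContinuousLinearMap
    (fun z => ?_) (fun z => ?_) (fun z => ?_) fun z => ?_
  all_goals
    simp [ha, hc, Algebra.algebraMap_eq_smul_one, SU2.a, SU2.c, smul_smul, mul_comm]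

/-- Schur's lemma supplies the scalars required by `exists_plane`; the resulting plane is an
isometric copy of some two-dimensional `π_{(a,c)}` inside `π`. -/
theorem exists_rep_equivalent_of_ne_zero (hπ : π.IsIrreducible)
    (hα : π.hom (SUq.alpha (-1)) ≠ 0) (hγ : π.hom (SUq.gamma (-1)) ≠ 0) :
    ∃ x : SU2, x.rep.Equivalent π := by
  have hr := (SUq.rel (-1)).map π.hom
  set A := π.hom (SUq.alpha (-1)) with hA
  set C := π.hom (SUq.gamma (-1)) with hC
  have := hr.isStarNormal_left
  have := hr.isStarNormal_right
  have hAn : Commute A (star A) := (star_comm_self' A).symm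
  have hCn : Commute C (star C) := (star_comm_self' C).symm
  have hnormal : ∀ X : π.H →L[ℂ] π.H, Commute X (star X) → IsStarNormal (X * X) := fun X h => by
    refine ⟨?_⟩
    rw [star_mul]
    exact (h.symm.mul_left h.symm).mul_right (h.symm.mul_left h.symm)
  have := hnormal A hAn
  have := hnormal C hCn
  have := (IsSelfAdjoint.star_mul_self A).isStarNormal
  have e1 := hr.mul_eq_neg
  have e2 := hr.mul_star_eq_neg
  have e3 := hr.star_mul_eq_neg
  have e4 := hr.star_mul_star_eq_neg
  have f1 : C * A = -(A * C) := by rw [e1, neg_neg]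
  have f3 : C * star A = -(star A * C) := by rw [e3, neg_neg]
  obtain ⟨l, hl⟩ := hπ.exists_eq_algebraMap (A * A) (SUq.commute_of_gen π.hom
    ((Commute.refl A).mul_left (.refl A)) (hAn.mul_left hAn) (commute_mul_of_anticommute e1 e1)
    (commute_mul_of_anticommute e2 e2))
  obtain ⟨m, hm⟩ := hπ.exists_eq_algebraMap (C * C) (SUq.commute_of_gen π.hom
    (commute_mul_of_anticommute f1 f1) (commute_mul_of_anticommute f3 f3)
    ((Commute.refl C).mul_left (.refl C)) (hCn.mul_left hCn))
  obtain ⟨p, hp⟩ := hπ.exists_eq_algebraMap (star A * A) (SUq.commute_of_gen π.hom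
    (hAn.symm.mul_left (.refl A)) ((Commute.refl _).mul_left hAn) (commute_mul_of_anticommute e3 e1)
    (commute_mul_of_anticommute e4 e2))
  have hq : star C * C = algebraMap ℂ _ (1 - p) := by
    rw [map_sub, map_one, ← hp, ← hr.rel_one, add_sub_cancel_left]
  obtain ⟨x, v, w, hx, hv, hw, hvw, ⟨hAv, hAw⟩, ⟨hAv', hAw'⟩, ⟨hCv, hCw⟩, ⟨hCv', hCw'⟩⟩ :=
    exists_plane e1 hα hγ hl hm hp hq (add_sub_cancel _ _)
  refine ⟨x, ?_⟩
  rw [rep_of_ne x hx]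
  set T := planeEmbedding hv hw hvw
  have hT : ∀ u, T u = u 0 • v + u 1 • w := fun _ => rfl
  refine hπ.equivalent_of_isometry (ρ := ⟨C2, _⟩) T ?_
  refine SUq.intertwines x.twoDim _ T.toContinuousLinearMap
    (fun u => ?_) (fun u => ?_) (fun u => ?_) fun u => ?_
  · rw [twoDim_alpha]
    simp only [LinearIsometry.coe_toContinuousLinearMap, hT, ← hA, map_add, map_smul, hAv, hAw]
    simp [Matrix.vecHead, Matrix.vecTail, smul_smul, mul_comm]
  · rw [star_twoDim_alpha]
    simp only [LinearIsometry.coe_toContinuousLinearMap, hT, ← hA, map_add, map_smul, hAv', hAw']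
    simp [Matrix.vecHead, Matrix.vecTail, smul_smul, mul_comm]
  · rw [twoDim_gamma]
    simp only [LinearIsometry.coe_toContinuousLinearMap, hT, ← hC, map_add, map_smul, hCv, hCw]
    simp [Matrix.vecHead, Matrix.vecTail, smul_smul, mul_comm]
    exact add_comm _ _
  · rw [star_twoDim_gamma]
    simp only [LinearIsometry.coe_toContinuousLinearMap, hT, ← hC, map_add, map_smul, hCv', hCw']
    simp [Matrix.vecHead, Matrix.vecTail, smul_smul, mul_comm]
    exact add_comm _ _

/-- Every irreducible representation of `C(SU_{-1}(2))` is equivalent to some `π_{(a,c)}`. -/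
theorem exists_rep_equivalent (hπ : π.IsIrreducible) : ∃ x : SU2, x.rep.Equivalent π := by
  have hr := (SUq.rel (-1)).map π.hom
  have := hr.isStarNormal_left
  have := hr.isStarNormal_right
  by_cases hγ : π.hom (SUq.gamma (-1)) = 0
  · obtain ⟨a, ha⟩ := hπ.exists_eq_algebraMap (π.hom (SUq.alpha (-1))) (SUq.commute_of_gen π.hom
      (.refl _) (star_comm_self' _).symm (by simp [hγ]) (by simp [hγ]))
    exact exists_rep_equivalent_of_scalar hπ ha (by rw [hγ, map_zero]) (mul_zero a)
  by_cases hα : π.hom (SUq.alpha (-1)) = 0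
  · obtain ⟨c, hc⟩ := hπ.exists_eq_algebraMap (π.hom (SUq.gamma (-1))) (SUq.commute_of_gen π.hom
      (by simp [hα]) (by simp [hα]) (.refl _) (star_comm_self' _).symm)
    exact exists_rep_equivalent_of_scalar hπ (by rw [hα, map_zero]) hc (zero_mul c)
  · exact exists_rep_equivalent_of_ne_zero hπ hα hγ

end SU2

/-! ### The topology of the spectrum and the homeomorphism -/

theorem CStarSpectrum.isClosed_iff {A : Type*} [CStarAlgebra A] {Z : Set (CStarSpectrum A)} :
    IsClosed Z ↔ ∃ S : Set A, Z = CStarSpectrum.toPrim ⁻¹' PrimitiveIdeal.hull S := by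
  have h : ∀ Y : Set (PrimitiveIdeal A), IsClosed Y ↔ ∃ S : Set A, Y = PrimitiveIdeal.hull S := by
    intro Y
    rw [← isOpen_compl_iff]
    change Yᶜᶜ ∈ {Z | ∃ S : Set A, Z = PrimitiveIdeal.hull S} ↔ _
    rw [compl_compl]; rfl
  rw [isClosed_induced_iff]
  constructor
  · rintro ⟨Y, hY, rfl⟩
    obtain ⟨S, rfl⟩ := (h Y).1 hY
    exact ⟨S, rfl⟩
  · rintro ⟨S, rfl⟩
    exact ⟨_, (h _).2 ⟨S, rfl⟩, rfl⟩

namespace SU2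

theorem repClass_mem_preimage_hull {x : SU2} {S : Set (SUq (-1))} :
    x.repClass ∈ CStarSpectrum.toPrim ⁻¹' PrimitiveIdeal.hull S ↔ ∀ s ∈ S, x.rep.hom s = 0 :=
  forall₂_congr fun _ _ => HilbertRep.mem_kernel

/-- Equivalence classes are finite, so a single class can serve as the closed set in
`exists_separating`. -/
theorem isClosed_setOf_rel (x : SU2) : IsClosed {y | Rel x y} := by
  refine (Set.Finite.subset (s := x.orbit) (by simp [orbit]) ?_).isClosed
  rintro y (rfl | h)
  · exact Or.inl rfl
  · exact h.2

end SU2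

theorem PiMap_continuous : Continuous PiMap := by
  rw [continuous_iff_isClosed]
  intro Z hZ
  obtain ⟨S, rfl⟩ := CStarSpectrum.isClosed_iff.1 hZ
  rw [← isQuotientMap_quotient_mk'.isClosed_preimage]
  have h : (Quotient.mk SU2.setoid) ⁻¹' (PiMap ⁻¹' (CStarSpectrum.toPrim ⁻¹' PrimitiveIdeal.hull S)) =
      ⋂ s ∈ S, {x : SU2 | x.rep.hom s = 0} := by
    ext x
    simp only [Set.mem_iInter]
    exact SU2.repClass_mem_preimage_hull
  exact h ▸ isClosed_biInter fun s _ => SU2.isClosed_setOf_rep_hom_eq_zero s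

theorem PiMap_surjective : Function.Surjective PiMap := by
  intro p
  induction p using Quotient.ind with
  | _ π =>
    obtain ⟨x, hx⟩ := SU2.exists_rep_equivalent π.2
    exact ⟨Quotient.mk _ x, Quotient.sound hx⟩

/-- Points in different classes are already told apart by their kernels: an element vanishing on the
class of `x` survives at `y`. -/
theorem PiMap_injective : Function.Injective PiMap := by
  intro p p'
  induction p using Quotient.ind with
  | _ x =>
  induction p' using Quotient.ind with
  | _ y =>
    intro (h : x.repClass = y.repClass)
    by_contra hne
    obtain ⟨s, hs, hsy⟩ := SU2.exists_separating (y := y) (SU2.isClosed_setOf_rel x)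
      (fun z hz w hw => SU2.setoid.trans hz hw) (fun hxy => hne (Quotient.sound hxy))
    have hx := (SU2.repClass_mem_preimage_hull (x := x) (S := {s})).2 (by
      rintro _ rfl; exact hs x (SU2.setoid.refl x))
    rw [h, SU2.repClass_mem_preimage_hull] at hx
    exact hsy (hx s rfl)

/-- The image of a closed set is the hull of the elements vanishing on it; `exists_separating` shows
that this hull contains no further points. -/
theorem PiMap_isClosedMap : IsClosedMap PiMap := by
  intro Z hZ
  set F : Set SU2 := Quotient.mk SU2.setoid ⁻¹' Z with hF
  have hFc : IsClosed F := hZ.preimage continuous_quotient_mk'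
  have hsat : ∀ x ∈ F, ∀ y, SU2.Rel x y → y ∈ F := fun x hx y hxy => by
    have : Quotient.mk SU2.setoid x = Quotient.mk SU2.setoid y := Quotient.sound hxy
    rwa [hF, Set.mem_preimage, ← this]
  refine CStarSpectrum.isClosed_iff.2 ⟨{s | ∀ x ∈ F, x.rep.hom s = 0}, ?_⟩
  ext p
  obtain ⟨q, rfl⟩ := PiMap_surjective p
  rw [PiMap_injective.mem_set_image]
  induction q using Quotient.ind with
  | _ y =>
    refine Iff.trans ?_ (SU2.repClass_mem_preimage_hull (x := y)).symm
    refine ⟨fun hy s hs => hs y hy, fun h => ?_⟩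
    by_contra hy
    obtain ⟨s, hs, hsy⟩ := SU2.exists_separating hFc hsat hy
    exact hsy (h s hs)

theorem theorem2p1 : IsHomeomorph PiMap :=
  isHomeomorph_iff_continuous_isClosedMap_bijective.2
    ⟨PiMap_continuous, PiMap_isClosedMap, PiMap_injective, PiMap_surjective⟩
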